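/- Let $p$ be a known number of components, let $K\subset\mathbb R$ be compact, let $\Theta=(K\times K\times[0,\pi]\times[0,\pi])^p\subset\mathbb R^{4p}$, and let $\theta_0=(A_1^0,B_1^0,\lambda_1^0,\mu_1^0,\dots,A_p^0,B_p^0,\lambda_p^0,\mu_p^0)$ be an interior point of $\Theta$. Assume that the model has $p$ genuine components: $(A_k^0,B_k^0)\neq(0,0)$ for every $k$, and $(\lambda_j^0,\mu_j^0)\neq(\lambda_k^0,\mu_k^0)$ for $j\ne k$. One observes $$y(t,s)=\sum_{k=1}^p\Big(A_k^0\cos(\lambda_k^0t+\mu_k^0s)+B_k^0\sin(\lambda_k^0t+\mu_k^0s)\Big)+\epsilon(t,s),\qquad 1\le t\le T,\ 1\le s\le S,$$ where the $\epsilon(t,s)$, $t,s\ge1$, are i.i.d. real random variables with distribution function $G$ and continuous probability density $g$ such that $0$ is the unique median of $G$ (that is, $G(x)=\tfrac12$ if and only if $x=0$), $g$ is differentiable everywhere with bounded derivative $g'$, and $\mathbb E[\epsilon(t,s)^2]<\infty$. For $T,S\ge1$ let the least absolute deviation (LAD) estimator $\hat\theta_{T,S}$ be any minimizer over $\theta=(A_1,B_1,\lambda_1,\mu_1,\dots,A_p,B_p,\lambda_p,\mu_p)\in\Theta$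 of $$Q_{T,S}(\theta)=\frac1{TS}\sum_{t=1}^T\sum_{s=1}^S\Big|y(t,s)-\sum_{k=1}^p\big(A_k\cos(\lambda_kt+\mu_ks)+B_k\sin(\lambda_kt+\mu_ks)\big)\Big|.$$ Then $\hat\theta_{T,S}$ is strongly consistent for $\theta_0$, up to the labelling of the components: almost surely there are permutations $\sigma_{T,S}$ of $\{1,\dots,p\}$ such that the vector obtained from $\hat\theta_{T,S}$ by listing its $p$ quadruples $(\hat A_k,\hat B_k,\hat\lambda_k,\hat\mu_k)$ in the order $\sigma_{T,S}(1),\dots,\sigma_{T,S}(p)$ converges to $\theta_0$ as $\min\{T,S\}\to\infty$. In particular, for $p=1$, $\hat\theta_{T,S}\to\theta_0$ almost surely. -/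

import Mathlib

open MeasureTheory ProbabilityTheory Filter Topology

namespace LAD2D

noncomputable section

/-- The space of parameter vectors `(A₁, B₁, λ₁, μ₁, …, A_p, B_p, λ_p, μ_p)`, i.e. `ℝ^{4p}` (with its
usual topology), grouped as one quadruple `(A_k, B_k, λ_k, μ_k)` per component. -/
abbrev Param (p : ℕ) : Type := Fin p → ℝ × ℝ × ℝ × ℝ

namespace Param

variable {p : ℕ}

/-- The cosine amplitude `A_k`. -/
def A (θ : Param p) (k : Fin p) : ℝ := (θ k).1

/-- The sine amplitude `B_k`. -/
def B (θ : Param p) (k : Fin p) : ℝ := (θ k).2.1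

/-- The first frequency `λ_k`. -/
def freq₁ (θ : Param p) (k : Fin p) : ℝ := (θ k).2.2.1

/-- The second frequency `μ_k`. -/
def freq₂ (θ : Param p) (k : Fin p) : ℝ := (θ k).2.2.2

end Param

/-- The deterministic part
`∑ₖ (A_k cos(λ_k t + μ_k s) + B_k sin(λ_k t + μ_k s))` of the model. -/
def signal {p : ℕ} (θ : Param p) (t s : ℕ) : ℝ :=
  ∑ k : Fin p,
    (θ.A k * Real.cos (θ.freq₁ k * t + θ.freq₂ k * s)
      + θ.B k * Real.sin (θ.freq₁ k * t + θ.freq₂ k * s))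

/-- The LAD objective function
`Q_{T,S}(θ) = (1 / TS) ∑_{t=1}^T ∑_{s=1}^S |y(t,s) - signal θ t s|`, for `T, S ≥ 1`. -/
def objective {p : ℕ} (y : ℕ → ℕ → ℝ) (T S : ℕ) (θ : Param p) : ℝ :=
  1 / ((T : ℝ) * (S : ℝ)) *
    ∑ t ∈ Finset.Icc 1 T, ∑ s ∈ Finset.Icc 1 S, |y t s - signal θ t s|

/-- The parameter space `Θ = (K × K × [0,π] × [0,π])^p`. -/
def paramSpace (p : ℕ) (K : Set ℝ) : Set (Param p) :=
  Set.univ.pi fun _ : Fin p =>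
    K ×ˢ (K ×ˢ (Set.Icc 0 Real.pi ×ˢ Set.Icc 0 Real.pi))

/-- The model has `p` genuine components: no component vanishes identically, and distinct
components have distinct frequency pairs. -/
def HasGenuineComponents {p : ℕ} (θ : Param p) : Prop :=
  (∀ k, θ.A k ≠ 0 ∨ θ.B k ≠ 0) ∧
    ∀ j k, j ≠ k → (θ.freq₁ j, θ.freq₂ j) ≠ (θ.freq₁ k, θ.freq₂ k)

/-- The assumptions on the noise `ε(t,s)`, `t, s ≥ 1` (the values at `t = 0` or `s = 0` are
irrelevant): i.i.d. with distribution function `G` and continuous density `g`, the median `0` of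
`G` is unique, `g` is differentiable with bounded derivative, and the second moment is finite. -/
structure NoiseAssumption {Ω : Type*} [MeasurableSpace Ω] (P : Measure Ω)
    (ε : ℕ → ℕ → Ω → ℝ) (G g : ℝ → ℝ) : Prop where
  measurable : ∀ t s, 1 ≤ t → 1 ≤ s → Measurable (ε t s)
  indep : iIndepFun (fun i : ℕ × ℕ => ε (i.1 + 1) (i.2 + 1)) P
  distribution : ∀ t s, 1 ≤ t → 1 ≤ s → ∀ x, P.real {ω | ε t s ω ≤ x} = G x
  density_nonneg : ∀ x, 0 ≤ g x
  density : ∀ t s, 1 ≤ t → 1 ≤ s →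
    P.map (ε t s) = volume.withDensity fun x => ENNReal.ofReal (g x)
  density_continuous : Continuous g
  median : ∀ x, G x = 1 / 2 ↔ x = 0
  density_differentiable : Differentiable ℝ g
  density_deriv_bounded : ∃ C : ℝ, ∀ x, |deriv g x| ≤ C
  second_moment : ∀ t s, 1 ≤ t → 1 ≤ s → Integrable (fun ω => ε t s ω ^ 2) P

/-- `θhat T S ω` is, for all `T, S ≥ 1` and every outcome `ω`, a minimizer over `Θ` of the LAD
objective function of the observations `y(t,s)(ω)`, `1 ≤ t ≤ T`, `1 ≤ s ≤ S`. The minimizer need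
not be unique; any choice is allowed. -/
def IsLADEstimator {Ω : Type*} {p : ℕ} (Θ : Set (Param p)) (y : ℕ → ℕ → Ω → ℝ)
    (θhat : ℕ → ℕ → Ω → Param p) : Prop :=
  ∀ T S, 1 ≤ T → 1 ≤ S → ∀ ω,
    θhat T S ω ∈ Θ ∧
      ∀ θ ∈ Θ, objective (fun t s => y t s ω) T S (θhat T S ω)
        ≤ objective (fun t s => y t s ω) T S θ

end

end LAD2D

/-! Write `d` for `signal θ₀ - signal θ`. Minimality of the estimator, tested against `θ₀`, says
that the sum of `|ε + d| - |ε|` is nonpositive. Up to an error `o(TS)`, uniform over a box of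
parameters, this sum equals the sum of its expectations `meanGain`. For the uniformity, Hoeffding's
inequality is applied on a grid of mesh of order `1/(T+S)`: the number of grid points is polynomial
in `T+S`, the tail bound is exponential in `TS`, and Borel–Cantelli concludes
(`ae_finite_deviation_gt`). Uniqueness of the median bounds the expected gain below by `κ (|x| - τ)`
for any `τ > 0` and some `κ > 0` (`exists_le_meanGain`). Hence the mean of `|d|` tends to `0` at the
estimator (`tendsto_objective_signal`).

The parameters are recovered in `exists_perm_of_tendsto_objective`. By compactness the estimator
converges along any ultrafilter. Signals that agree in mean have asymptotically equal demodulations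
at every frequency, so each true frequency is a limit frequency, which defines a permutation. The
amplitudes are subtler: a frequency error of order `1/T` vanishes in the limit but leaves a factor,
a limit `w` of averages of exponentials. Demodulating at the true and at the estimated frequency
gives two relations that force `|w| = 1`, and `eq_one_of_tendsto_expMean` then gives `w = 1`. -/

namespace LAD2D

/-! ### Averages of exponentials -/

/-- The average `T⁻¹ ∑_{t=1}^T e^{iαt}`. -/
noncomputable def expMean (T : ℕ) (α : ℝ) : ℂ :=
  (T : ℂ)⁻¹ * ∑ t ∈ Finset.Icc 1 T, Complex.exp (α * Complex.I) ^ t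

lemma sum_Icc_pow_mul_sub_one (z : ℂ) (T : ℕ) :
    (∑ t ∈ Finset.Icc 1 T, z ^ t) * (z - 1) = z ^ (T + 1) - z := by
  induction T with
  | zero => simp
  | succ n ih =>
    rw [Finset.sum_Icc_succ_top (by omega), add_mul, ih]
    ring

lemma norm_exp_pow (α : ℝ) (t : ℕ) : ‖Complex.exp (α * Complex.I) ^ t‖ = 1 := by
  rw [norm_pow, Complex.norm_exp_ofReal_mul_I, one_pow]

lemma norm_expMean_le (T : ℕ) (α : ℝ) : ‖expMean T α‖ ≤ 1 := by
  unfold expMean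
  rw [norm_mul, norm_inv, Complex.norm_natCast]
  have h : ‖∑ t ∈ Finset.Icc 1 T, Complex.exp (α * Complex.I) ^ t‖ ≤ T := by
    refine (norm_sum_le _ _).trans ?_
    simp
  calc (T : ℝ)⁻¹ * _ ≤ (T : ℝ)⁻¹ * T := by gcongr
    _ ≤ 1 := inv_mul_le_one

lemma expMean_zero {T : ℕ} (hT : T ≠ 0) : expMean T 0 = 1 := by
  simp [expMean, hT]

lemma expMean_neg (T : ℕ) (α : ℝ) : expMean T (-α) = (starRingEnd ℂ) (expMean T α) := by
  unfold expMean
  simp [← Complex.exp_conj]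

lemma exp_mul_I_ne_one {α : ℝ} (h0 : α ≠ 0) (h1 : |α| < 2 * Real.pi) :
    Complex.exp (α * Complex.I) ≠ 1 := by
  intro h
  obtain ⟨n, hn⟩ := Complex.exp_eq_one_iff.1 h
  have h2 : α = n * (2 * Real.pi) := by
    have := congrArg Complex.im hn
    simpa using this
  rw [h2, abs_mul, abs_of_pos Real.two_pi_pos] at h1
  have h3 : |(n : ℝ)| < 1 := by
    by_contra hc
    nlinarith [Real.two_pi_pos]
  have h4 : n = 0 := by
    rw [← Int.abs_lt_one_iff]
    exact_mod_cast h3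
  exact h0 (by simp [h2, h4])

/-- Averages of exponentials vanish asymptotically if the frequency stays away from `2πℤ`. -/
lemma tendsto_expMean_zero {ι : Type*} {l : Filter ι} {T : ι → ℕ} (hT : Tendsto T l atTop)
    {α : ι → ℝ} {a : ℝ} (hα : Tendsto α l (𝓝 a)) (ha : Complex.exp (a * Complex.I) ≠ 1) :
    Tendsto (fun i => expMean (T i) (α i)) l (𝓝 0) := by
  set z : ι → ℂ := fun i => Complex.exp (α i * Complex.I) with hz
  have hzlim : Tendsto z l (𝓝 (Complex.exp (a * Complex.I))) := by
    have hc : Continuous fun x : ℝ => Complex.exp (x * Complex.I) := by fun_prop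
    exact (hc.tendsto a).comp hα
  have hz1 : Tendsto (fun i => z i - 1) l (𝓝 (Complex.exp (a * Complex.I) - 1)) :=
    hzlim.sub_const 1
  have hinv : Tendsto (fun i => ((T i : ℝ))⁻¹ * 2) l (𝓝 0) := by
    simpa using ((tendsto_inv_atTop_zero.comp (tendsto_natCast_atTop_atTop.comp hT)).mul_const
      (2 : ℝ))
  have hnum : Tendsto (fun i => expMean (T i) (α i) * (z i - 1)) l (𝓝 0) := by
    refine squeeze_zero_norm (fun i => ?_) hinv
    unfold expMean
    rw [mul_assoc, sum_Icc_pow_mul_sub_one, norm_mul, norm_inv, Complex.norm_natCast]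
    gcongr
    refine (norm_sub_le _ _).trans ?_
    rw [norm_exp_pow, Complex.norm_exp_ofReal_mul_I]
    norm_num
  have hne : Complex.exp (a * Complex.I) - 1 ≠ 0 := sub_ne_zero.2 ha
  have hdiv := hnum.div hz1 hne
  rw [zero_div] at hdiv
  refine hdiv.congr' ?_
  filter_upwards [hz1.eventually_ne hne] with i hi
  simp only [Pi.div_apply]
  field_simp

/-- If `|w| = 1` and the averages tend to `w`, the right side is `o(T)`: the powers are then close
to `w` in quadratic mean. -/
lemma sum_norm_sub_sq (T : ℕ) (α : ℝ) (w : ℂ) :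
    ∑ t ∈ Finset.Icc 1 T, ‖Complex.exp (α * Complex.I) ^ t - w‖ ^ 2
      = T * (1 + ‖w‖ ^ 2 - 2 * (expMean T α * (starRingEnd ℂ) w).re) := by
  rcases Nat.eq_zero_or_pos T with rfl | hT
  · simp
  have hT' : (T : ℂ) ≠ 0 := by exact_mod_cast hT.ne'
  have h1 : ∀ t : ℕ, ‖Complex.exp (α * Complex.I) ^ t - w‖ ^ 2
      = 1 + ‖w‖ ^ 2 - 2 * (Complex.exp (α * Complex.I) ^ t * (starRingEnd ℂ) w).re := by
    intro t
    rw [← Complex.normSq_eq_norm_sq, Complex.normSq_sub, Complex.normSq_eq_norm_sq,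
      Complex.normSq_eq_norm_sq, norm_exp_pow, one_pow]
  have h2 : (T : ℂ) * (expMean T α * (starRingEnd ℂ) w)
      = ∑ t ∈ Finset.Icc 1 T, Complex.exp (α * Complex.I) ^ t * (starRingEnd ℂ) w := by
    unfold expMean
    rw [← Finset.sum_mul]
    field_simp
  have h3 : (T : ℝ) * (expMean T α * (starRingEnd ℂ) w).re
      = ∑ t ∈ Finset.Icc 1 T, (Complex.exp (α * Complex.I) ^ t * (starRingEnd ℂ) w).re := by
    rw [← Complex.re_sum, ← h2]
    simp
  simp_rw [h1]
  rw [Finset.sum_sub_distrib, ← Finset.mul_sum, ← h3]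
  simp
  ring

/-- If the averages of exponentials converge to a number of modulus one, that number is `1`. -/
lemma eq_one_of_tendsto_expMean {ι : Type*} {l : Filter ι} [l.NeBot] {T : ι → ℕ}
    (hT : Tendsto T l atTop) {α : ι → ℝ} {w : ℂ}
    (hw : Tendsto (fun i => expMean (T i) (α i)) l (𝓝 w)) (hw1 : ‖w‖ = 1) : w = 1 := by
  set r : ι → ℝ := fun i => 1 + ‖w‖ ^ 2 - 2 * (expMean (T i) (α i) * (starRingEnd ℂ) w).re with hr
  have hrlim : Tendsto r l (𝓝 0) := by
    have h1 : Tendsto (fun i => (expMean (T i) (α i) * (starRingEnd ℂ) w).re) l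
        (𝓝 (w * (starRingEnd ℂ) w).re) :=
      (Complex.continuous_re.tendsto _).comp (hw.mul_const _)
    have h2 : (w * (starRingEnd ℂ) w).re = 1 := by
      rw [Complex.mul_conj, Complex.normSq_eq_norm_sq, hw1]; simp
    rw [h2] at h1
    have h3 : Tendsto r l (𝓝 (1 + ‖w‖ ^ 2 - 2 * 1)) := (h1.const_mul 2).const_sub (1 + ‖w‖ ^ 2)
    convert h3 using 2
    rw [hw1]
    norm_num
  -- Most powers `z ^ t` are close to `w`, and so are most even powers `z ^ (2 * t)`, which are also
  -- close to `w ^ 2`; hence `w ^ 2 = w`. The constant is `(8 + 2) * 3`: the weights in `hpt`, and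
  -- `T ≤ 3 ⌊T/2⌋` for `T ≥ 2`.
  have hbound : ∀ᶠ i in l, ‖w ^ 2 - w‖ ^ 2 ≤ 30 * r i := by
    filter_upwards [hT.eventually_ge_atTop 2] with i hi
    set z := Complex.exp (α i * Complex.I) with hz
    have htot : ∑ t ∈ Finset.Icc 1 (T i), ‖z ^ t - w‖ ^ 2 = T i * r i :=
      sum_norm_sub_sq (T i) (α i) w
    have hlow : ∑ t ∈ Finset.Icc 1 (T i / 2), ‖z ^ t - w‖ ^ 2 ≤ T i * r i := by
      rw [← htot]
      refine Finset.sum_le_sum_of_subset_of_nonneg ?_ fun _ _ _ => by positivity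
      exact Finset.Icc_subset_Icc le_rfl (Nat.div_le_self _ _)
    have heven : ∑ t ∈ Finset.Icc 1 (T i / 2), ‖z ^ (2 * t) - w‖ ^ 2 ≤ T i * r i := by
      rw [← htot, ← Finset.sum_image (f := fun t => ‖z ^ t - w‖ ^ 2) (g := fun t => 2 * t)
        (fun a _ b _ h => by simpa using h)]
      refine Finset.sum_le_sum_of_subset_of_nonneg ?_ fun _ _ _ => by positivity
      intro t ht
      simp only [Finset.mem_image, Finset.mem_Icc] at ht ⊢
      omega
    have hpt : ∀ t : ℕ, ‖w ^ 2 - w‖ ^ 2 ≤ 8 * ‖z ^ t - w‖ ^ 2 + 2 * ‖z ^ (2 * t) - w‖ ^ 2 := by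
      intro t
      have h1 : ‖w ^ 2 - w‖ ≤ 2 * ‖z ^ t - w‖ + ‖z ^ (2 * t) - w‖ := by
        have e : w ^ 2 - w = -((z ^ t + w) * (z ^ t - w)) + (z ^ (2 * t) - w) := by ring
        rw [e]
        refine (norm_add_le _ _).trans ?_
        rw [norm_neg, norm_mul]
        gcongr
        refine (norm_add_le _ _).trans ?_
        rw [hz, norm_exp_pow, hw1]
        norm_num
      have h2 : ‖w ^ 2 - w‖ ^ 2 ≤ (2 * ‖z ^ t - w‖ + ‖z ^ (2 * t) - w‖) ^ 2 := by gcongr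
      nlinarith [sq_nonneg (2 * ‖z ^ t - w‖ - ‖z ^ (2 * t) - w‖)]
    have hsum : (T i / 2 : ℕ) * ‖w ^ 2 - w‖ ^ 2 ≤ 10 * (T i * r i) := by
      have := Finset.sum_le_sum fun t (_ : t ∈ Finset.Icc 1 (T i / 2)) => hpt t
      rw [Finset.sum_add_distrib, ← Finset.mul_sum, ← Finset.mul_sum] at this
      simp only [Finset.sum_const, Nat.card_Icc, nsmul_eq_mul, Nat.add_sub_cancel] at this
      linarith
    have h3 : (T i : ℝ) ≤ 3 * (T i / 2 : ℕ) := by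
      have : T i ≤ 3 * (T i / 2) := by omega
      exact_mod_cast this
    have hTpos : (0 : ℝ) < T i := by
      have : 0 < T i := by omega
      exact_mod_cast this
    have h4 : (T i : ℝ) * ‖w ^ 2 - w‖ ^ 2 ≤ T i * (30 * r i) := by
      nlinarith [sq_nonneg ‖w ^ 2 - w‖]
    exact le_of_mul_le_mul_left h4 hTpos
  have h0 : ‖w ^ 2 - w‖ ^ 2 ≤ 0 := by
    have := ge_of_tendsto (hrlim.const_mul 30) hbound
    simpa using this
  have h1 : w * (w - 1) = 0 := by
    have : ‖w ^ 2 - w‖ = 0 := by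
      have h2 := sq_nonneg ‖w ^ 2 - w‖
      exact pow_eq_zero_iff (two_ne_zero) |>.1 (le_antisymm h0 h2)
    rw [norm_eq_zero] at this
    rw [← this]; ring
  rcases mul_eq_zero.1 h1 with h | h
  · simp [h] at hw1
  · exact sub_eq_zero.1 h

/-! ### Demodulation -/

/-- The single component `a cos(λt + μs) + b sin(λt + μs)` of the model. -/
noncomputable def component (q : ℝ × ℝ × ℝ × ℝ) (t s : ℕ) : ℝ :=
  q.1 * Real.cos (q.2.2.1 * t + q.2.2.2 * s) + q.2.1 * Real.sin (q.2.2.1 * t + q.2.2.2 * s)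

lemma signal_eq_sum_component {p : ℕ} (θ : Param p) (t s : ℕ) :
    signal θ t s = ∑ k, component (θ k) t s := rfl

/-- The complex amplitude `a - ib` of a component. -/
noncomputable def amplitude (q : ℝ × ℝ × ℝ × ℝ) : ℂ := q.1 - q.2.1 * Complex.I

/-- The average of `f(t,s) e^{-i(αt + βs)}` over `1 ≤ t ≤ T`, `1 ≤ s ≤ S`. -/
noncomputable def demod (T S : ℕ) (ν : ℝ × ℝ) (f : ℕ → ℕ → ℝ) : ℂ :=
  (T : ℂ)⁻¹ * (S : ℂ)⁻¹ * ∑ t ∈ Finset.Icc 1 T, ∑ s ∈ Finset.Icc 1 S,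
    (f t s : ℂ) * (Complex.exp ((-ν.1 : ℝ) * Complex.I) ^ t
      * Complex.exp ((-ν.2 : ℝ) * Complex.I) ^ s)

lemma demod_sub (T S : ℕ) (ν : ℝ × ℝ) (f g : ℕ → ℕ → ℝ) :
    demod T S ν (fun t s => f t s - g t s) = demod T S ν f - demod T S ν g := by
  simp only [demod, Complex.ofReal_sub, sub_mul, Finset.sum_sub_distrib, mul_sub]

lemma demod_sum {κ : Type*} (T S : ℕ) (ν : ℝ × ℝ) (u : Finset κ) (f : κ → ℕ → ℕ → ℝ) :
    demod T S ν (fun t s => ∑ k ∈ u, f k t s) = ∑ k ∈ u, demod T S ν (f k) := by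
  simp only [demod, Complex.ofReal_sum, Finset.sum_mul, ← Finset.mul_sum]
  congr 1
  simp_rw [Finset.sum_comm (s := Finset.Icc 1 S)]
  rw [Finset.sum_comm]

/-- The demodulating weights have modulus one. The bound is uniform in `ν`, so `ν` may later depend
on the sample. -/
lemma norm_demod_sub_le {p : ℕ} (T S : ℕ) (ν : ℝ × ℝ) (f : ℕ → ℕ → ℝ) (θ : Param p) :
    ‖demod T S ν (fun t s => f t s - signal θ t s)‖ ≤ objective f T S θ := by
  unfold demod objective
  rw [norm_mul, norm_mul, norm_inv, norm_inv, Complex.norm_natCast, Complex.norm_natCast,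
    one_div, mul_inv]
  gcongr
  refine (norm_sum_le _ _).trans (Finset.sum_le_sum fun t _ => ?_)
  refine (norm_sum_le _ _).trans (Finset.sum_le_sum fun s _ => ?_)
  rw [norm_mul, norm_mul, norm_exp_pow, norm_exp_pow, Complex.norm_real, Real.norm_eq_abs]
  simp

lemma expMean_mul_expMean (T S : ℕ) (α β : ℝ) :
    expMean T α * expMean S β = (T : ℂ)⁻¹ * (S : ℂ)⁻¹ *
      ∑ t ∈ Finset.Icc 1 T, ∑ s ∈ Finset.Icc 1 S,
        Complex.exp (α * Complex.I) ^ t * Complex.exp (β * Complex.I) ^ s := by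
  unfold expMean
  rw [← Finset.sum_mul_sum]
  ring

lemma exp_pow_mul_exp_pow (α β : ℝ) (t s : ℕ) :
    Complex.exp (α * Complex.I) ^ t * Complex.exp (β * Complex.I) ^ s
      = Real.cos (α * t + β * s) + Real.sin (α * t + β * s) * Complex.I := by
  rw [← Complex.exp_nat_mul, ← Complex.exp_nat_mul, ← Complex.exp_add, Complex.ofReal_cos,
    Complex.ofReal_sin, ← Complex.exp_mul_I]
  congr 1
  push_cast
  ring

lemma two_mul_component (q : ℝ × ℝ × ℝ × ℝ) (t s : ℕ) :
    (2 : ℂ) * (component q t s : ℂ)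
      = amplitude q * (Complex.exp (q.2.2.1 * Complex.I) ^ t
          * Complex.exp (q.2.2.2 * Complex.I) ^ s)
        + (starRingEnd ℂ) (amplitude q) * (Complex.exp ((-q.2.2.1 : ℝ) * Complex.I) ^ t
          * Complex.exp ((-q.2.2.2 : ℝ) * Complex.I) ^ s) := by
  rw [exp_pow_mul_exp_pow, exp_pow_mul_exp_pow]
  have h : -q.2.2.1 * t + -q.2.2.2 * s = -(q.2.2.1 * t + q.2.2.2 * s) := by ring
  rw [h, Real.cos_neg, Real.sin_neg]
  unfold component amplitude
  simp only [map_sub, map_mul, Complex.conj_ofReal, Complex.conj_I, Complex.ofReal_neg,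
    Complex.ofReal_add, Complex.ofReal_mul]
  generalize Real.cos (q.2.2.1 * t + q.2.2.2 * s) = c
  generalize Real.sin (q.2.2.1 * t + q.2.2.2 * s) = d
  linear_combination (2 * (q.2.1 : ℂ) * d) * Complex.I_mul_I

lemma exp_sub_pow (α ν : ℝ) (t : ℕ) :
    Complex.exp ((α - ν : ℝ) * Complex.I) ^ t
      = Complex.exp (α * Complex.I) ^ t * Complex.exp ((-ν : ℝ) * Complex.I) ^ t := by
  rw [← mul_pow, ← Complex.exp_add]
  congr 2
  push_cast
  ring

lemma two_mul_demod_component (T S : ℕ) (ν : ℝ × ℝ) (q : ℝ × ℝ × ℝ × ℝ) :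
    2 * demod T S ν (component q)
      = amplitude q * (expMean T (q.2.2.1 - ν.1) * expMean S (q.2.2.2 - ν.2))
        + (starRingEnd ℂ) (amplitude q)
          * (expMean T (-q.2.2.1 - ν.1) * expMean S (-q.2.2.2 - ν.2)) := by
  rw [expMean_mul_expMean, expMean_mul_expMean]
  unfold demod
  rw [mul_left_comm, mul_left_comm (amplitude q), mul_left_comm ((starRingEnd ℂ) (amplitude q)),
    ← mul_add]
  congr 1
  simp_rw [Finset.mul_sum, ← Finset.sum_add_distrib]
  refine Finset.sum_congr rfl fun t _ => Finset.sum_congr rfl fun s _ => ?_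
  rw [← mul_assoc, two_mul_component]
  simp_rw [exp_sub_pow]
  ring

section Limits

variable {ι : Type*} {l : Filter ι} {T S : ι → ℕ}

lemma tendsto_expMean_mul_zero (hT : Tendsto T l atTop) (hS : Tendsto S l atTop)
    {α β : ι → ℝ} {a b : ℝ} (hα : Tendsto α l (𝓝 a)) (hβ : Tendsto β l (𝓝 b))
    (ha : |a| < 2 * Real.pi) (hb : |b| < 2 * Real.pi) (hab : a ≠ 0 ∨ b ≠ 0) :
    Tendsto (fun i => expMean (T i) (α i) * expMean (S i) (β i)) l (𝓝 0) := by
  rcases hab with h | h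
  · have h1 := tendsto_expMean_zero hT hα (exp_mul_I_ne_one h ha)
    refine squeeze_zero_norm (fun i => ?_) (tendsto_zero_iff_norm_tendsto_zero.1 h1)
    rw [norm_mul]
    exact mul_le_of_le_one_right (norm_nonneg _) (norm_expMean_le _ _)
  · have h1 := tendsto_expMean_zero hS hβ (exp_mul_I_ne_one h hb)
    refine squeeze_zero_norm (fun i => ?_) (tendsto_zero_iff_norm_tendsto_zero.1 h1)
    rw [norm_mul]
    exact mul_le_of_le_one_left (norm_nonneg _) (norm_expMean_le _ _)

lemma continuous_amplitude : Continuous amplitude := by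
  unfold amplitude
  fun_prop

variable {q : ι → ℝ × ℝ × ℝ × ℝ} {q₀ : ℝ × ℝ × ℝ × ℝ} {ν : ι → ℝ × ℝ} {ν₀ : ℝ × ℝ}

/-- Only the conjugate exponential has to vanish. Its limiting first frequency `-(λ + ν)` lies
strictly between `-2π` and `0`, because `ν₀` is interior. -/
lemma tendsto_demod_component_sub (hT : Tendsto T l atTop) (hS : Tendsto S l atTop)
    (hq : Tendsto q l (𝓝 q₀)) (hν : Tendsto ν l (𝓝 ν₀))
    (hq₁ : q₀.2.2.1 ∈ Set.Icc 0 Real.pi) (hq₂ : q₀.2.2.2 ∈ Set.Icc 0 Real.pi)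
    (hν₁ : ν₀.1 ∈ Set.Ioo 0 Real.pi) (hν₂ : ν₀.2 ∈ Set.Ioo 0 Real.pi) :
    Tendsto (fun i => 2 * demod (T i) (S i) (ν i) (component (q i))
      - amplitude (q i) * (expMean (T i) ((q i).2.2.1 - (ν i).1)
        * expMean (S i) ((q i).2.2.2 - (ν i).2))) l (𝓝 0) := by
  have hz := tendsto_expMean_mul_zero hT hS
    (α := fun i => -(q i).2.2.1 - (ν i).1) (β := fun i => -(q i).2.2.2 - (ν i).2)
    (a := -q₀.2.2.1 - ν₀.1) (b := -q₀.2.2.2 - ν₀.2)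
    ((hq.snd_nhds.snd_nhds.fst_nhds.neg).sub hν.fst_nhds)
    ((hq.snd_nhds.snd_nhds.snd_nhds.neg).sub hν.snd_nhds)
    (by rw [abs_lt]; constructor <;> linarith [hq₁.1, hq₁.2, hν₁.1, hν₁.2])
    (by rw [abs_lt]; constructor <;> linarith [hq₂.1, hq₂.2, hν₂.1, hν₂.2])
    (Or.inl (by linarith [hq₁.1, hν₁.1] : -q₀.2.2.1 - ν₀.1 < 0).ne)
  have hc : Tendsto (fun i => (starRingEnd ℂ) (amplitude (q i))) l
      (𝓝 ((starRingEnd ℂ) (amplitude q₀))) :=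
    ((Complex.continuous_conj.comp continuous_amplitude).tendsto q₀).comp hq
  have := hc.mul hz
  rw [mul_zero] at this
  refine this.congr fun i => ?_
  rw [two_mul_demod_component]
  ring

/-- Frequency differences are less than `2π` in absolute value, so distinct frequency pairs remain
distinct modulo `2π`. -/
lemma tendsto_demod_component_zero (hT : Tendsto T l atTop) (hS : Tendsto S l atTop)
    (hq : Tendsto q l (𝓝 q₀)) (hν : Tendsto ν l (𝓝 ν₀))
    (hq₁ : q₀.2.2.1 ∈ Set.Icc 0 Real.pi) (hq₂ : q₀.2.2.2 ∈ Set.Icc 0 Real.pi)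
    (hν₁ : ν₀.1 ∈ Set.Ioo 0 Real.pi) (hν₂ : ν₀.2 ∈ Set.Ioo 0 Real.pi)
    (hne : q₀.2.2 ≠ ν₀) :
    Tendsto (fun i => 2 * demod (T i) (S i) (ν i) (component (q i))) l (𝓝 0) := by
  have h0 := tendsto_demod_component_sub hT hS hq hν hq₁ hq₂ hν₁ hν₂
  have hz := tendsto_expMean_mul_zero hT hS
    (α := fun i => (q i).2.2.1 - (ν i).1) (β := fun i => (q i).2.2.2 - (ν i).2)
    (a := q₀.2.2.1 - ν₀.1) (b := q₀.2.2.2 - ν₀.2)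
    (hq.snd_nhds.snd_nhds.fst_nhds.sub hν.fst_nhds)
    (hq.snd_nhds.snd_nhds.snd_nhds.sub hν.snd_nhds)
    (by rw [abs_lt]; constructor <;> linarith [hq₁.1, hq₁.2, hν₁.1, hν₁.2])
    (by rw [abs_lt]; constructor <;> linarith [hq₂.1, hq₂.2, hν₂.1, hν₂.2])
    (by
      by_contra! h
      exact hne (Prod.ext (sub_eq_zero.1 h.1) (sub_eq_zero.1 h.2)))
  have h1 := ((continuous_amplitude.tendsto q₀).comp hq).mul hz
  rw [mul_zero] at h1
  have h2 := h0.add h1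
  rw [add_zero] at h2
  refine h2.congr fun i => ?_
  simp only [Function.comp]
  ring

/-- Demodulating a signal at a frequency asymptotically isolates the component that may have this
frequency in the limit. -/
lemma tendsto_sum_demod_sub {p : ℕ} (hT : Tendsto T l atTop) (hS : Tendsto S l atTop)
    {θ : ι → Param p} {τ : Param p} (hθ : Tendsto θ l (𝓝 τ)) (hν : Tendsto ν l (𝓝 ν₀))
    (hτ₁ : ∀ k, τ.freq₁ k ∈ Set.Icc 0 Real.pi) (hτ₂ : ∀ k, τ.freq₂ k ∈ Set.Icc 0 Real.pi)
    (hν₁ : ν₀.1 ∈ Set.Ioo 0 Real.pi) (hν₂ : ν₀.2 ∈ Set.Ioo 0 Real.pi)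
    (m : Fin p) (hm : ∀ k, k ≠ m → (τ k).2.2 ≠ ν₀) :
    Tendsto (fun i => ∑ k, 2 * demod (T i) (S i) (ν i) (component (θ i k))
      - amplitude (θ i m) * (expMean (T i) ((θ i m).2.2.1 - (ν i).1)
        * expMean (S i) ((θ i m).2.2.2 - (ν i).2))) l (𝓝 0) := by
  have hθk : ∀ k, Tendsto (fun i => θ i k) l (𝓝 (τ k)) := fun k => tendsto_pi_nhds.1 hθ k
  have h1 : Tendsto (fun i => ∑ k ∈ Finset.univ.erase m,
      2 * demod (T i) (S i) (ν i) (component (θ i k))) l (𝓝 0) := by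
    have := tendsto_finsetSum (Finset.univ.erase m) fun k hk =>
      tendsto_demod_component_zero hT hS (hθk k) hν (hτ₁ k) (hτ₂ k) hν₁ hν₂
        (hm k (Finset.ne_of_mem_erase hk))
    simpa using this
  have h2 := h1.add (tendsto_demod_component_sub hT hS (hθk m) hν (hτ₁ m) (hτ₂ m) hν₁ hν₂)
  rw [add_zero] at h2
  refine h2.congr fun i => ?_
  rw [← Finset.sum_erase_add _ _ (Finset.mem_univ m)]
  ring

/-- Demodulating a signal at the frequency of one of its components asymptotically yields the
amplitude of this component. -/
lemma tendsto_sum_demod_amplitude {p : ℕ} (hT : Tendsto T l atTop) (hS : Tendsto S l atTop)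
    {θ : ι → Param p} {τ : Param p} (hθ : Tendsto θ l (𝓝 τ))
    (hτ₁ : ∀ k, τ.freq₁ k ∈ Set.Icc 0 Real.pi) (hτ₂ : ∀ k, τ.freq₂ k ∈ Set.Icc 0 Real.pi)
    (m : Fin p) (hm₁ : τ.freq₁ m ∈ Set.Ioo 0 Real.pi) (hm₂ : τ.freq₂ m ∈ Set.Ioo 0 Real.pi)
    (hm : ∀ k, k ≠ m → (τ k).2.2 ≠ (τ m).2.2) :
    Tendsto (fun i => ∑ k, 2 * demod (T i) (S i) (θ i m).2.2 (component (θ i k))) l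
      (𝓝 (amplitude (τ m))) := by
  have hθm : Tendsto (fun i => θ i m) l (𝓝 (τ m)) := tendsto_pi_nhds.1 hθ m
  have h := (tendsto_sum_demod_sub hT hS hθ hθm.snd_nhds.snd_nhds hτ₁ hτ₂ hm₁ hm₂ m hm).add
    ((continuous_amplitude.tendsto (τ m)).comp hθm)
  rw [zero_add] at h
  refine h.congr' ?_
  filter_upwards [hT.eventually_ne_atTop 0, hS.eventually_ne_atTop 0] with i hi hi'
  rw [sub_self, sub_self, expMean_zero hi, expMean_zero hi']
  simp only [Function.comp]
  ring

end Limits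

/-! ### Identifiability -/

lemma amplitude_ne_zero {q : ℝ × ℝ × ℝ × ℝ} (h : q.1 ≠ 0 ∨ q.2.1 ≠ 0) : amplitude q ≠ 0 := by
  intro h0
  have h1 := congrArg Complex.re h0
  have h2 := congrArg Complex.im h0
  simp [amplitude] at h1 h2
  rcases h with h | h
  · exact h h1
  · exact h h2

lemma eq_of_amplitude_eq {q r : ℝ × ℝ × ℝ × ℝ} (h : amplitude q = amplitude r)
    (h' : q.2.2 = r.2.2) : q = r := by
  have h1 := congrArg Complex.re h
  have h2 := congrArg Complex.im h
  simp [amplitude] at h1 h2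
  exact Prod.ext h1 (Prod.ext h2 h')

/-- Limits along an ultrafilter of averages of exponentials. -/
lemma exists_tendsto_expMean {ι : Type*} (U : Ultrafilter ι) (T : ι → ℕ) (α : ι → ℝ) :
    ∃ w : ℂ, ‖w‖ ≤ 1 ∧ Tendsto (fun i => expMean (T i) (α i)) U (𝓝 w) := by
  have hc : IsCompact (Metric.closedBall (0 : ℂ) 1) := isCompact_closedBall _ _
  obtain ⟨w, hw, h⟩ := hc.ultrafilter_le_nhds (U.map fun i => expMean (T i) (α i))
    (by
      rw [le_principal_iff]
      refine Filter.mem_map.2 (Filter.mem_of_superset Filter.univ_mem fun i _ => ?_)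
      simpa using norm_expMean_le (T i) (α i))
  exact ⟨w, by simpa using hw, h⟩

/-- Identifiability: a limit point of parameters whose signals asymptotically agree in mean with
that of `θ₀` is a relabelling of `θ₀`. -/
theorem exists_perm_of_tendsto_objective {p : ℕ} {ι : Type*} (U : Ultrafilter ι) {T S : ι → ℕ}
    (hT : Tendsto T U atTop) (hS : Tendsto S U atTop) {θ₀ : Param p}
    (hcomp : HasGenuineComponents θ₀)
    (hθ₁ : ∀ k, θ₀.freq₁ k ∈ Set.Ioo 0 Real.pi) (hθ₂ : ∀ k, θ₀.freq₂ k ∈ Set.Ioo 0 Real.pi)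
    {θ : ι → Param p} {τ : Param p} (hθ : Tendsto θ U (𝓝 τ))
    (hτ₁ : ∀ k, τ.freq₁ k ∈ Set.Icc 0 Real.pi) (hτ₂ : ∀ k, τ.freq₂ k ∈ Set.Icc 0 Real.pi)
    (hobj : Tendsto (fun i => objective (signal θ₀) (T i) (S i) (θ i)) U (𝓝 0)) :
    ∃ σ : Equiv.Perm (Fin p), ∀ k, τ (σ k) = θ₀ k := by
  have hθk : ∀ k, Tendsto (fun i => θ i k) U (𝓝 (τ k)) := fun k => tendsto_pi_nhds.1 hθ k
  have hdiff : ∀ ν : ι → ℝ × ℝ, Tendsto (fun i =>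
      ∑ k, 2 * demod (T i) (S i) (ν i) (component (θ₀ k))
        - ∑ k, 2 * demod (T i) (S i) (ν i) (component (θ i k))) U (𝓝 0) := by
    intro ν
    have h := hobj.const_mul 2
    rw [mul_zero] at h
    refine squeeze_zero_norm (fun i => ?_) h
    rw [← Finset.mul_sum, ← Finset.mul_sum, ← demod_sum, ← demod_sum, ← mul_sub, ← demod_sub,
      norm_mul]
    simp only [← signal_eq_sum_component]
    rw [Complex.norm_ofNat]
    gcongr
    exact norm_demod_sub_le _ _ _ _ _
  have hinj : ∀ j k, (θ₀ j).2.2 = (θ₀ k).2.2 → j = k := by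
    intro j k h
    by_contra hjk
    exact hcomp.2 j k hjk h
  have hθ₀₁ : ∀ k, θ₀.freq₁ k ∈ Set.Icc 0 Real.pi := fun k => Set.Ioo_subset_Icc_self (hθ₁ k)
  have hθ₀₂ : ∀ k, θ₀.freq₂ k ∈ Set.Icc 0 Real.pi := fun k => Set.Ioo_subset_Icc_self (hθ₂ k)
  have hself : ∀ j, Tendsto (fun i => ∑ k, 2 * demod (T i) (S i) (θ₀ j).2.2 (component (θ₀ k)))
      U (𝓝 (amplitude (θ₀ j))) := fun j =>
    tendsto_sum_demod_amplitude hT hS (θ := fun _ => θ₀) tendsto_const_nhds hθ₀₁ hθ₀₂ j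
      (hθ₁ j) (hθ₂ j) fun k hk h => hk (hinj _ _ h)
  -- Otherwise demodulation at the `j`-th true frequency would give the nonzero amplitude of `θ₀ j`
  -- for one signal and `0` for the other.
  have hex : ∀ j, ∃ k, (τ k).2.2 = (θ₀ j).2.2 := by
    intro j
    by_contra! hne
    have hν : Tendsto (fun _ : ι => (θ₀ j).2.2) U (𝓝 (θ₀ j).2.2) := tendsto_const_nhds
    have h1 : Tendsto (fun i => ∑ k, 2 * demod (T i) (S i) (θ₀ j).2.2 (component (θ i k)))
        U (𝓝 0) := by
      have := tendsto_finsetSum Finset.univ fun k _ =>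
        tendsto_demod_component_zero hT hS (hθk k) hν (hτ₁ k) (hτ₂ k) (hθ₁ j) (hθ₂ j) (hne k)
      simpa using this
    have h2 := hself j
    have h3 := tendsto_nhds_unique (h2.sub h1) (hdiff fun _ => (θ₀ j).2.2)
    rw [sub_zero] at h3
    exact amplitude_ne_zero (hcomp.1 j) h3
  choose f hf using hex
  have hfinj : Function.Injective f := fun j k h => hinj j k (by rw [← hf j, ← hf k, h])
  let σ : Equiv.Perm (Fin p) := Equiv.ofBijective f (Finite.injective_iff_bijective.1 hfinj)
  have hσ : ∀ j, (τ (σ j)).2.2 = (θ₀ j).2.2 := hf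
  have hτne : ∀ j k, k ≠ σ j → (τ k).2.2 ≠ (θ₀ j).2.2 := by
    intro j k hk h
    obtain ⟨m, rfl⟩ := σ.surjective k
    rw [hσ] at h
    exact hk (by rw [hinj _ _ h])
  refine ⟨σ, fun j => ?_⟩
  -- The frequency differences tend to `0`, but possibly no faster than `1/T` and `1/S`, so these
  -- limits are not known to be `1` yet.
  obtain ⟨w₁, hw₁, hlim₁⟩ := exists_tendsto_expMean U T
    fun i => (θ i (σ j)).2.2.1 - (θ₀ j).2.2.1
  obtain ⟨w₂, hw₂, hlim₂⟩ := exists_tendsto_expMean U S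
    fun i => (θ i (σ j)).2.2.2 - (θ₀ j).2.2.2
  have hampσ : Tendsto (fun i => amplitude (θ i (σ j))) U (𝓝 (amplitude (τ (σ j)))) :=
    (continuous_amplitude.tendsto _).comp (hθk _)
  -- demodulation at the true frequency
  have hA : amplitude (θ₀ j) = amplitude (τ (σ j)) * (w₁ * w₂) := by
    have h1 := (tendsto_sum_demod_sub hT hS hθ
      (ν := fun _ => (θ₀ j).2.2) tendsto_const_nhds hτ₁ hτ₂ (hθ₁ j) (hθ₂ j) (σ j) (hτne j)).add
      (hampσ.mul (hlim₁.mul hlim₂))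
    simp only [sub_add_cancel, zero_add] at h1
    have h2 := tendsto_nhds_unique ((hself j).sub h1) (hdiff fun _ => (θ₀ j).2.2)
    exact sub_eq_zero.1 h2
  -- demodulation at the estimated frequency
  have hB : amplitude (τ (σ j)) = amplitude (θ₀ j) * (starRingEnd ℂ) (w₁ * w₂) := by
    have hconj : Tendsto (fun i => expMean (T i) ((θ₀ j).2.2.1 - (θ i (σ j)).2.2.1)
        * expMean (S i) ((θ₀ j).2.2.2 - (θ i (σ j)).2.2.2)) U
        (𝓝 ((starRingEnd ℂ) (w₁ * w₂))) := by
      refine ((Complex.continuous_conj.tendsto _).comp (hlim₁.mul hlim₂)).congr fun i => ?_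
      simp only [Function.comp, map_mul]
      rw [← expMean_neg, ← expMean_neg, neg_sub, neg_sub]
    have h1 := (tendsto_sum_demod_sub hT hS (θ := fun _ => θ₀) tendsto_const_nhds
      (hθk (σ j)).snd_nhds.snd_nhds hθ₀₁ hθ₀₂ (by rw [hσ]; exact hθ₁ j) (by rw [hσ]; exact hθ₂ j)
      j fun k hk h => hk (hinj _ _ (h.trans (hσ j)))).add
      (hconj.const_mul (amplitude (θ₀ j)))
    simp only [sub_add_cancel, zero_add] at h1
    have h2 := tendsto_sum_demod_amplitude hT hS hθ hτ₁ hτ₂ (σ j)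
      (by unfold Param.freq₁; rw [hσ]; exact hθ₁ j) (by unfold Param.freq₂; rw [hσ]; exact hθ₂ j)
      fun k hk h => hτne j k hk (h.trans (hσ j))
    have h3 := tendsto_nhds_unique (h1.sub h2) (hdiff fun i => (θ i (σ j)).2.2)
    exact (sub_eq_zero.1 h3).symm
  have hnz := amplitude_ne_zero (hcomp.1 j)
  -- Substituting `hB` into `hA` gives `|w₁ w₂|² = 1`; as both factors lie in the unit disc, each
  -- has modulus one.
  have hw : ‖w₁‖ * ‖w₂‖ = 1 := by
    have h1 : amplitude (θ₀ j) * 1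
        = amplitude (θ₀ j) * ((starRingEnd ℂ) (w₁ * w₂) * (w₁ * w₂)) := by
      rw [← mul_assoc, ← hB, mul_one, ← hA]
    have h2 := mul_left_cancel₀ hnz h1
    have h3 := congrArg norm h2
    rw [norm_mul, RCLike.norm_conj, norm_mul, norm_one] at h3
    nlinarith [norm_nonneg w₁, norm_nonneg w₂, mul_nonneg (norm_nonneg w₁) (norm_nonneg w₂)]
  have hn₁ : ‖w₁‖ = 1 := by nlinarith [norm_nonneg w₁, norm_nonneg w₂]
  have hn₂ : ‖w₂‖ = 1 := by nlinarith [norm_nonneg w₁, norm_nonneg w₂]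
  have he₁ := eq_one_of_tendsto_expMean hT hlim₁ hn₁
  have he₂ := eq_one_of_tendsto_expMean hS hlim₂ hn₂
  refine eq_of_amplitude_eq ?_ (hσ j)
  rw [hA, he₁, he₂, mul_one, mul_one]

/-! ### Expected gain and concentration -/

section Noise

variable {Ω : Type*} [MeasurableSpace Ω] (P : Measure Ω)

/-- The expected increase `E(|X + x| - |X|)` of the absolute error caused by a shift `x`. -/
noncomputable def meanGain (X : Ω → ℝ) (x : ℝ) : ℝ := ∫ ω, (|X ω + x| - |X ω|) ∂P

lemma abs_abs_add_sub_le (e x : ℝ) : |(|e + x| - |e|)| ≤ |x| := by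
  have := abs_abs_sub_abs_le_abs_sub (e + x) e
  simpa using this

variable {P}

lemma meanGain_congr_law {X Y : Ω → ℝ} (hX : Measurable X) (hY : Measurable Y)
    (h : P.map X = P.map Y) : meanGain P X = meanGain P Y := by
  funext x
  have hm : Measurable fun e : ℝ => |e + x| - |e| := by fun_prop
  unfold meanGain
  rw [← integral_map (f := fun e : ℝ => |e + x| - |e|) hX.aemeasurable
      hm.aestronglyMeasurable, h,
    integral_map (f := fun e : ℝ => |e + x| - |e|) hY.aemeasurable hm.aestronglyMeasurable]

variable [IsProbabilityMeasure P]

lemma integrable_gain {X : Ω → ℝ} (hX : Measurable X) (x : ℝ) :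
    Integrable (fun ω => |X ω + x| - |X ω|) P := by
  refine Integrable.of_bound (C := |x|) ?_ (ae_of_all _ fun ω => ?_)
  · have : Measurable (fun ω => |X ω + x| - |X ω|) := by fun_prop
    exact this.aestronglyMeasurable
  · rw [Real.norm_eq_abs]
    exact abs_abs_add_sub_le _ _

lemma abs_meanGain_sub_le {X : Ω → ℝ} (hX : Measurable X) (x y : ℝ) :
    |meanGain P X x - meanGain P X y| ≤ |x - y| := by
  unfold meanGain
  rw [← integral_sub (integrable_gain hX x) (integrable_gain hX y)]
  have := norm_integral_le_of_norm_le_const (μ := P) (C := |x - y|)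
    (f := fun ω => |X ω + x| - |X ω| - (|X ω + y| - |X ω|)) (ae_of_all _ fun ω => by
      rw [Real.norm_eq_abs]
      have h := abs_abs_sub_abs_le_abs_sub (X ω + x) (X ω + y)
      have e : |X ω + x| - |X ω| - (|X ω + y| - |X ω|) = |X ω + x| - |X ω + y| := by ring
      rw [e]
      simpa using h)
  simpa using this

variable {G : ℝ → ℝ}

lemma integral_indicator_le {X : Ω → ℝ} (hX : Measurable X)
    (hG : ∀ x, P.real {ω | X ω ≤ x} = G x) (x c : ℝ) :
    Integrable (Set.indicator {ω | X ω ≤ x} fun _ => c) P ∧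
      ∫ ω, Set.indicator {ω | X ω ≤ x} (fun _ => c) ω ∂P = c * G x := by
  have hm : MeasurableSet {ω | X ω ≤ x} := measurableSet_le hX measurable_const
  refine ⟨(integrable_const c).indicator hm, ?_⟩
  rw [integral_indicator_const _ hm, hG, smul_eq_mul, mul_comm]

/-- Integrate the pointwise bound `|e + x| - |e| ≥ x (1 - 1_{e ≤ 0} - 1_{e ≤ -x/2})`: the gain is
`x` for `e > 0`, is nonnegative for `-x/2 < e ≤ 0`, and is always at least `-x`. -/
lemma le_meanGain_of_pos {X : Ω → ℝ} (hX : Measurable X)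
    (hG : ∀ x, P.real {ω | X ω ≤ x} = G x) (hG0 : G 0 = 1 / 2) {x : ℝ} (hx : 0 < x) :
    x * (1 / 2 - G (-x / 2)) ≤ meanGain P X x := by
  obtain ⟨i1, e1⟩ := integral_indicator_le hX hG 0 x
  obtain ⟨i2, e2⟩ := integral_indicator_le hX hG (-x / 2) x
  have i0 : Integrable (fun ω => x - Set.indicator {ω | X ω ≤ 0} (fun _ => x) ω) P :=
    (integrable_const x).sub i1
  have h : ∫ ω, (x - Set.indicator {ω | X ω ≤ 0} (fun _ => x) ω
      - Set.indicator {ω | X ω ≤ -x / 2} (fun _ => x) ω) ∂P ≤ meanGain P X x := by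
    refine integral_mono (i0.sub i2) (integrable_gain hX x) fun ω => ?_
    simp only [Set.indicator_apply, Set.mem_ofPred_eq]
    split_ifs <;> cases abs_cases (X ω + x) <;> cases abs_cases (X ω) <;> linarith
  rw [integral_sub i0 i2, integral_sub (integrable_const x) i1, e1, e2,
    integral_const, hG0] at h
  simp at h
  linarith

lemma le_meanGain_neg_of_pos {X : Ω → ℝ} (hX : Measurable X)
    (hG : ∀ x, P.real {ω | X ω ≤ x} = G x) (hG0 : G 0 = 1 / 2) {x : ℝ} (hx : 0 < x) :
    x * (G (x / 2) - 1 / 2) ≤ meanGain P X (-x) := by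
  obtain ⟨i1, e1⟩ := integral_indicator_le hX hG 0 x
  obtain ⟨i2, e2⟩ := integral_indicator_le hX hG (x / 2) x
  have i0 : Integrable (fun ω => -x + Set.indicator {ω | X ω ≤ 0} (fun _ => x) ω) P :=
    (integrable_const (-x)).add i1
  have h : ∫ ω, (-x + Set.indicator {ω | X ω ≤ 0} (fun _ => x) ω
      + Set.indicator {ω | X ω ≤ x / 2} (fun _ => x) ω) ∂P ≤ meanGain P X (-x) := by
    refine integral_mono (i0.add i2) (integrable_gain hX (-x))
      fun ω => ?_
    simp only [Set.indicator_apply, Set.mem_ofPred_eq]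
    split_ifs <;> cases abs_cases (X ω + -x) <;> cases abs_cases (X ω) <;> linarith
  rw [integral_add i0 i2, integral_add (integrable_const (-x)) i1,
    e1, e2, integral_const, hG0] at h
  simp at h
  linarith

/-- If the median `0` is unique, the expected gain grows at least linearly away from `0`. -/
lemma exists_le_meanGain {X : Ω → ℝ} (hX : Measurable X)
    (hG : ∀ x, P.real {ω | X ω ≤ x} = G x) (hmed : ∀ x, G x = 1 / 2 ↔ x = 0) {τ : ℝ}
    (hτ : 0 < τ) : ∃ κ > 0, ∀ x, κ * (|x| - τ) ≤ meanGain P X x := by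
  have hG0 : G 0 = 1 / 2 := (hmed 0).2 rfl
  have hmono : Monotone G := by
    intro a b hab
    rw [← hG, ← hG]
    exact measureReal_mono fun ω (h : X ω ≤ a) => h.trans hab
  have hlow : G (-τ / 2) < 1 / 2 := by
    refine lt_of_le_of_ne (by rw [← hG0]; exact hmono (by linarith)) fun h => ?_
    have := (hmed _).1 h
    linarith
  have hhigh : 1 / 2 < G (τ / 2) := by
    refine lt_of_le_of_ne (by rw [← hG0]; exact hmono (by linarith)) fun h => ?_
    have := (hmed _).1 h.symm
    linarith
  refine ⟨min (1 / 2 - G (-τ / 2)) (G (τ / 2) - 1 / 2),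
    lt_min (by linarith) (by linarith), fun x => ?_⟩
  set κ := min (1 / 2 - G (-τ / 2)) (G (τ / 2) - 1 / 2) with hκ
  have hκ0 : 0 < κ := lt_min (by linarith) (by linarith)
  have hκ1 : κ ≤ 1 / 2 - G (-τ / 2) := min_le_left _ _
  have hκ2 : κ ≤ G (τ / 2) - 1 / 2 := min_le_right _ _
  rcases lt_trichotomy x 0 with hx | rfl | hx
  · have h := le_meanGain_neg_of_pos hX hG hG0 (neg_pos.2 hx)
    rw [neg_neg] at h
    rw [abs_of_neg hx]
    -- Within `τ` of `0` the claimed bound is nonpositive and the gain nonnegative; beyond `τ`,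
    -- monotonicity of `G` gives at least `κ |x|`.
    rcases le_total (-x) τ with hle | hle
    · have h1 : G 0 ≤ G (-x / 2) := hmono (by linarith)
      nlinarith
    · have h1 : G (τ / 2) ≤ G (-x / 2) := hmono (by linarith)
      nlinarith
  · have : meanGain P X 0 = 0 := by simp [meanGain]
    rw [this, abs_zero]
    nlinarith
  · have h := le_meanGain_of_pos hX hG hG0 hx
    rw [abs_of_pos hx]
    rcases le_total x τ with hle | hle
    · have h1 : G (-x / 2) ≤ G 0 := hmono (by linarith)
      nlinarith
    · have h1 : G (-x / 2) ≤ G (-τ / 2) := hmono (by linarith)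
      nlinarith

/-- Hoeffding's inequality for the fluctuations of absolute errors under bounded shifts. -/
lemma measureReal_sum_gain_ge_le {ι : Type*} {X : ι → Ω → ℝ} (hX : ∀ i, Measurable (X i))
    (hind : iIndepFun X P) {c : ι → ℝ} {M : ℝ} (hM : 0 < M) (hc : ∀ i, |c i| ≤ M)
    (u : Finset ι) {η : ℝ} (hη : 0 ≤ η) :
    P.real {ω | η * u.card ≤ |∑ i ∈ u, (|X i ω + c i| - |X i ω| - meanGain P (X i) (c i))|}
      ≤ 2 * Real.exp (-(η ^ 2 / (2 * M ^ 2)) * u.card) := by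
  set Y : ι → Ω → ℝ := fun i ω => |X i ω + c i| - |X i ω| - meanGain P (X i) (c i) with hY
  have hYind : iIndepFun Y P :=
    hind.comp (fun i e => |e + c i| - |e| - meanGain P (X i) (c i)) fun i => by fun_prop
  have hNind : iIndepFun (fun i => -Y i) P :=
    hYind.comp (fun _ e => -e) fun _ => measurable_neg
  have hsub : ∀ i, HasSubgaussianMGF (Y i) ((‖M - -M‖₊ / 2) ^ 2) P := fun i => by
    refine hasSubgaussianMGF_of_mem_Icc (by have := hX i; fun_prop) (ae_of_all _ fun ω => ?_)
    exact abs_le.1 ((abs_abs_add_sub_le _ _).trans (hc i))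
  have hcoe : ((∑ i ∈ u, (‖M - -M‖₊ / 2) ^ 2 : NNReal) : ℝ) = u.card * M ^ 2 := by
    simp only [Finset.sum_const, nsmul_eq_mul, NNReal.coe_mul, NNReal.coe_natCast, NNReal.coe_pow,
      NNReal.coe_div, coe_nnnorm, NNReal.coe_ofNat, sub_neg_eq_add]
    rw [Real.norm_of_nonneg (by linarith)]
    ring
  have hexp : -(η * u.card) ^ 2 / (2 * (u.card * M ^ 2)) = -(η ^ 2 / (2 * M ^ 2)) * u.card := by
    rcases Nat.eq_zero_or_pos u.card with h | h
    · simp [h]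
    · field_simp
  have h0 : 0 ≤ η * u.card := by positivity
  have h1 := HasSubgaussianMGF.measure_sum_ge_le_of_iIndepFun hYind (s := u)
    (fun i _ => hsub i) h0
  have h2 := HasSubgaussianMGF.measure_sum_ge_le_of_iIndepFun hNind (s := u)
    (fun i _ => (hsub i).neg) h0
  rw [hcoe, hexp] at h1 h2
  calc _ ≤ P.real ({ω | η * u.card ≤ ∑ i ∈ u, Y i ω} ∪ {ω | η * u.card ≤ ∑ i ∈ u, (-Y i) ω}) := by
        refine measureReal_mono fun ω hω => ?_
        have hω' : η * u.card ≤ |∑ i ∈ u, Y i ω| := hω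
        rcases le_abs.1 hω' with h | h
        · exact Or.inl h
        · right
          simpa [Finset.sum_neg_distrib] using h
    _ ≤ _ := measureReal_union_le _ _
    _ ≤ _ := by linarith

end Noise

/-! ### Lipschitz bounds and grids -/

lemma abs_component_le {R : ℝ} {q : ℝ × ℝ × ℝ × ℝ} (hA : |q.1| ≤ R) (hB : |q.2.1| ≤ R)
    (t s : ℕ) : |component q t s| ≤ 2 * R := by
  unfold component
  refine (abs_add_le _ _).trans ?_
  rw [abs_mul, abs_mul]
  have h1 := Real.abs_cos_le_one (q.2.2.1 * t + q.2.2.2 * s)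
  have h2 := Real.abs_sin_le_one (q.2.2.1 * t + q.2.2.2 * s)
  have h3 := mul_le_mul hA h1 (abs_nonneg _) ((abs_nonneg _).trans hA)
  have h4 := mul_le_mul hB h2 (abs_nonneg _) ((abs_nonneg _).trans hB)
  linarith

lemma abs_signal_le {p : ℕ} {R : ℝ} {θ : Param p} (hA : ∀ k, |(θ k).1| ≤ R)
    (hB : ∀ k, |(θ k).2.1| ≤ R) (t s : ℕ) : |signal θ t s| ≤ p * (2 * R) := by
  rw [signal_eq_sum_component]
  refine (Finset.abs_sum_le_sum_abs _ _).trans ?_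
  refine (Finset.sum_le_sum fun k _ => abs_component_le (hA k) (hB k) t s).trans ?_
  simp

/-- Two quadruples are within `r` of each other, coordinate by coordinate. -/
def CoordClose (r : ℝ) (q q' : ℝ × ℝ × ℝ × ℝ) : Prop :=
  |q.1 - q'.1| ≤ r ∧ |q.2.1 - q'.2.1| ≤ r ∧ |q.2.2.1 - q'.2.2.1| ≤ r ∧ |q.2.2.2 - q'.2.2.2| ≤ r

lemma abs_component_sub_le {R r : ℝ} {q q' : ℝ × ℝ × ℝ × ℝ} (hA : |q'.1| ≤ R) (hB : |q'.2.1| ≤ R)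
    (h : CoordClose r q q') (t s : ℕ) :
    |component q t s - component q' t s| ≤ 2 * r + 2 * R * (r * (t + s)) := by
  obtain ⟨h1, h2, h3, h4⟩ := h
  unfold component
  set x := q.2.2.1 * t + q.2.2.2 * s with hx
  set x' := q'.2.2.1 * t + q'.2.2.2 * s with hx'
  have hxx : |x - x'| ≤ r * (t + s) := by
    have e : x - x' = (q.2.2.1 - q'.2.2.1) * t + (q.2.2.2 - q'.2.2.2) * s := by
      rw [hx, hx']; ring
    rw [e]
    refine (abs_add_le _ _).trans ?_
    rw [abs_mul, abs_mul, Nat.abs_cast, Nat.abs_cast, mul_add]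
    gcongr
  have hcos := (Real.abs_cos_sub_cos_le x x').trans hxx
  have hsin := (Real.abs_sin_sub_sin_le x x').trans hxx
  have hr : 0 ≤ r := (abs_nonneg _).trans h1
  have hR : 0 ≤ R := (abs_nonneg _).trans hA
  have e : q.1 * Real.cos x + q.2.1 * Real.sin x - (q'.1 * Real.cos x' + q'.2.1 * Real.sin x')
      = ((q.1 - q'.1) * Real.cos x + (q.2.1 - q'.2.1) * Real.sin x)
        + (q'.1 * (Real.cos x - Real.cos x') + q'.2.1 * (Real.sin x - Real.sin x')) := by ring
  rw [e]
  refine (abs_add_le _ _).trans ?_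
  have b1 : |(q.1 - q'.1) * Real.cos x| ≤ r * 1 := by
    rw [abs_mul]
    exact mul_le_mul h1 (Real.abs_cos_le_one x) (abs_nonneg _) hr
  have b2 : |(q.2.1 - q'.2.1) * Real.sin x| ≤ r * 1 := by
    rw [abs_mul]
    exact mul_le_mul h2 (Real.abs_sin_le_one x) (abs_nonneg _) hr
  have b3 : |q'.1 * (Real.cos x - Real.cos x')| ≤ R * (r * (t + s)) := by
    rw [abs_mul]
    exact mul_le_mul hA hcos (abs_nonneg _) hR
  have b4 : |q'.2.1 * (Real.sin x - Real.sin x')| ≤ R * (r * (t + s)) := by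
    rw [abs_mul]
    exact mul_le_mul hB hsin (abs_nonneg _) hR
  have c1 := abs_add_le ((q.1 - q'.1) * Real.cos x) ((q.2.1 - q'.2.1) * Real.sin x)
  have c2 := abs_add_le (q'.1 * (Real.cos x - Real.cos x')) (q'.2.1 * (Real.sin x - Real.sin x'))
  linarith

/-- A frequency error is multiplied by `t` or `s`. The factor `T + S` is what forces the mesh of the
grid to shrink with the sample. -/
lemma abs_signal_sub_le {p : ℕ} {R r : ℝ} (hr : 0 ≤ r) (hR : 0 ≤ R) {θ θ' : Param p}
    (hA : ∀ k, |(θ' k).1| ≤ R)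
    (hB : ∀ k, |(θ' k).2.1| ≤ R) (h : ∀ k, CoordClose r (θ k) (θ' k)) {t s T S : ℕ}
    (ht : t ∈ Finset.Icc 1 T) (hs : s ∈ Finset.Icc 1 S) :
    |signal θ t s - signal θ' t s| ≤ p * (2 * (1 + R) * r * (T + S)) := by
  rw [signal_eq_sum_component, signal_eq_sum_component, ← Finset.sum_sub_distrib]
  refine (Finset.abs_sum_le_sum_abs _ _).trans ?_
  refine (Finset.sum_le_sum fun k _ => abs_component_sub_le (hA k) (hB k) (h k) t s).trans ?_
  simp only [Finset.sum_const, Finset.card_univ, Fintype.card_fin, nsmul_eq_mul]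
  refine mul_le_mul_of_nonneg_left ?_ (Nat.cast_nonneg _)
  rw [Finset.mem_Icc] at ht hs
  have h1 : (1 : ℝ) ≤ T := by exact_mod_cast ht.1.trans ht.2
  have h2 : (t : ℝ) ≤ T := by exact_mod_cast ht.2
  have h3 : (s : ℝ) ≤ S := by exact_mod_cast hs.2
  have h0 : (0 : ℝ) ≤ S := Nat.cast_nonneg _
  have h4 : r * (t + s) ≤ r * (T + S) := by gcongr
  have h5 : R * (r * (t + s)) ≤ R * (r * (T + S)) := by gcongr
  nlinarith

/-- The grid point `-R + m / N` of `[-R, R]`. -/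
noncomputable def gridPoint (R N : ℕ) (m : Fin (2 * R * N + 1)) : ℝ := -R + m / N

lemma abs_gridPoint_le (R N : ℕ) (m : Fin (2 * R * N + 1)) : |gridPoint R N m| ≤ R := by
  unfold gridPoint
  have h1 : (m : ℝ) ≤ 2 * R * N := by
    have : (m : ℕ) ≤ 2 * R * N := Nat.lt_succ_iff.1 m.2
    exact_mod_cast this
  have h2 : (m : ℝ) / N ≤ 2 * R := by
    rcases Nat.eq_zero_or_pos N with h | h
    · simp [h]
    · rw [div_le_iff₀ (by exact_mod_cast h)]
      exact h1
  have h3 : (0 : ℝ) ≤ m / N := by positivity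
  rw [abs_le]
  constructor <;> linarith

lemma exists_gridPoint (R : ℕ) {N : ℕ} (hN : 0 < N) {x : ℝ} (hx : |x| ≤ R) :
    ∃ m, |x - gridPoint R N m| ≤ 1 / N := by
  rw [abs_le] at hx
  have hN' : (0 : ℝ) < N := by exact_mod_cast hN
  have h0 : 0 ≤ (x + R) * N := mul_nonneg (by linarith) hN'.le
  have hle : ⌊(x + R) * N⌋₊ ≤ 2 * R * N := by
    refine Nat.floor_le_of_le ?_
    push_cast
    gcongr
    linarith
  refine ⟨⟨⌊(x + R) * N⌋₊, Nat.lt_succ_iff.2 hle⟩, ?_⟩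
  have h1 := Nat.floor_le h0
  have h2 := Nat.lt_floor_add_one ((x + R) * N)
  unfold gridPoint
  have e : x - (-(R : ℝ) + (⌊(x + R) * N⌋₊ : ℝ) / N)
      = ((x + R) * N - ⌊(x + R) * N⌋₊) / N := by
    field_simp
    ring
  rw [e, abs_of_nonneg (div_nonneg (by linarith) hN'.le)]
  gcongr
  linarith

/-- Labels of the points of a grid in the parameter space. -/
abbrev GridLabel (p M : ℕ) : Type := Fin p → Fin M × Fin M × Fin M × Fin M

lemma card_gridLabel (p M : ℕ) : Fintype.card (GridLabel p M) = M ^ (4 * p) := by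
  simp only [Fintype.card_fun, Fintype.card_prod, Fintype.card_fin, pow_mul]
  ring

/-- The parameter vector with the given label. -/
noncomputable def gridParam {p : ℕ} (R N : ℕ) (m : GridLabel p (2 * R * N + 1)) : Param p :=
  fun k => (gridPoint R N (m k).1, gridPoint R N (m k).2.1, gridPoint R N (m k).2.2.1,
    gridPoint R N (m k).2.2.2)

/-- All coordinates of the parameter vector have absolute value at most `R`. -/
def InBox {p : ℕ} (R : ℝ) (θ : Param p) : Prop := ∀ k, CoordClose R (θ k) 0

lemma InBox.abs_fst_le {p : ℕ} {R : ℝ} {θ : Param p} (h : InBox R θ) (k : Fin p) :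
    |(θ k).1| ≤ R := by
  simpa using (h k).1

lemma InBox.abs_snd_le {p : ℕ} {R : ℝ} {θ : Param p} (h : InBox R θ) (k : Fin p) :
    |(θ k).2.1| ≤ R := by
  simpa using (h k).2.1

lemma inBox_gridParam {p : ℕ} (R N : ℕ) (m : GridLabel p (2 * R * N + 1)) :
    InBox R (gridParam R N m) := fun k => by
  refine ⟨?_, ?_, ?_, ?_⟩ <;> simpa [gridParam] using abs_gridPoint_le _ _ _

lemma exists_gridParam {p : ℕ} (R : ℕ) {N : ℕ} (hN : 0 < N) {θ : Param p} (hθ : InBox R θ) :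
    ∃ m, ∀ k, CoordClose (1 / N) (θ k) (gridParam R N m k) := by
  have h : ∀ k, ∃ m : Fin (2 * R * N + 1) × Fin (2 * R * N + 1) × Fin (2 * R * N + 1)
      × Fin (2 * R * N + 1), CoordClose (1 / N) (θ k) (gridPoint R N m.1, gridPoint R N m.2.1,
        gridPoint R N m.2.2.1, gridPoint R N m.2.2.2) := by
    intro k
    obtain ⟨h1, h2, h3, h4⟩ := hθ k
    simp only [Prod.fst_zero, Prod.snd_zero, sub_zero] at h1 h2 h3 h4
    obtain ⟨m1, hm1⟩ := exists_gridPoint R hN h1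
    obtain ⟨m2, hm2⟩ := exists_gridPoint R hN h2
    obtain ⟨m3, hm3⟩ := exists_gridPoint R hN h3
    obtain ⟨m4, hm4⟩ := exists_gridPoint R hN h4
    exact ⟨(m1, m2, m3, m4), hm1, hm2, hm3, hm4⟩
  choose m hm using h
  exact ⟨m, hm⟩

/-- The inequality `T + S ≤ 2TS` serves twice: it bounds the polynomial by a product and splits the
exponential, so that the double series factors. -/
lemma pow_mul_exp_le (C : ℝ) (d : ℕ) {c : ℝ} (hc : 0 < c) {T S : ℝ} {T' S' : ℕ} (hT' : T = T')
    (hS' : S = S') (hT : 1 ≤ T) (hS : 1 ≤ S) :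
    ‖(C * (T + S) + 1) ^ d * Real.exp (-c * (T * S))‖
      ≤ (2 * |C| + 1) ^ d * ((T ^ d * Real.exp (-c / 2) ^ T') * (S ^ d * Real.exp (-c / 2) ^ S')) := by
  have hsum : T + S ≤ 2 * (T * S) := by nlinarith
  have h1 : |C * (T + S) + 1| ≤ (2 * |C| + 1) * (T * S) := by
    refine (abs_add_le _ _).trans ?_
    rw [abs_mul, abs_one, abs_of_nonneg (by positivity : (0 : ℝ) ≤ T + S)]
    nlinarith [abs_nonneg C, mul_le_mul_of_nonneg_left hsum (abs_nonneg C)]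
  have h2 : Real.exp (-c * (T * S)) ≤ Real.exp (-c / 2) ^ T' * Real.exp (-c / 2) ^ S' := by
    rw [← Real.exp_nat_mul, ← Real.exp_nat_mul, ← Real.exp_add, ← hT', ← hS']
    refine Real.exp_le_exp.2 ?_
    nlinarith
  rw [norm_mul, norm_pow, Real.norm_eq_abs, Real.norm_of_nonneg (Real.exp_pos _).le]
  calc _ ≤ ((2 * |C| + 1) * (T * S)) ^ d
          * (Real.exp (-c / 2) ^ T' * Real.exp (-c / 2) ^ S') := by gcongr
    _ = _ := by rw [mul_pow, mul_pow]; ring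

/-- Summability behind the union bound over grids of polynomial size. -/
lemma summable_pow_mul_exp (C : ℝ) (d : ℕ) {c : ℝ} (hc : 0 < c) :
    Summable fun n : ℕ × ℕ => (C * ((n.1 + 1 : ℕ) + (n.2 + 1 : ℕ)) + 1) ^ d
      * Real.exp (-c * ((n.1 + 1 : ℕ) * (n.2 + 1 : ℕ))) := by
  have hρ1 : ‖Real.exp (-c / 2)‖ < 1 := by
    rw [Real.norm_of_nonneg (Real.exp_pos _).le, Real.exp_lt_one_iff]
    linarith
  set f : ℕ → ℝ := fun n => ((n + 1 : ℕ) : ℝ) ^ d * Real.exp (-c / 2) ^ (n + 1) with hf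
  have hs : Summable f := (summable_nat_add_iff
    (f := fun n : ℕ => (n : ℝ) ^ d * Real.exp (-c / 2) ^ n) 1).2
    (summable_pow_mul_geometric_of_norm_lt_one d hρ1)
  have hnn : 0 ≤ f :=
    fun n => mul_nonneg (pow_nonneg (Nat.cast_nonneg _) _) (pow_nonneg (Real.exp_pos _).le _)
  have hprod : Summable fun n : ℕ × ℕ => (2 * |C| + 1) ^ d * (f n.1 * f n.2) :=
    (hs.mul_of_nonneg hs hnn hnn).mul_left _
  refine Summable.of_norm_bounded hprod fun n => ?_
  have h1 : ∀ k : ℕ, (1 : ℝ) ≤ ((k + 1 : ℕ) : ℝ) := fun k => by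
    rw [Nat.one_le_cast]
    exact Nat.succ_pos k
  exact pow_mul_exp_le C d hc rfl rfl (h1 n.1) (h1 n.2)

lemma sum_Icc_one_eq_sum_range {M : Type*} [AddCommMonoid M] (f : ℕ → M) (T : ℕ) :
    ∑ t ∈ Finset.Icc 1 T, f t = ∑ i ∈ Finset.range T, f (i + 1) := by
  induction T with
  | zero => simp
  | succ n ih => rw [Finset.sum_Icc_succ_top (by omega), ih, Finset.sum_range_succ]

lemma sum_Icc_one_Icc_one {M : Type*} [AddCommMonoid M] (f : ℕ → ℕ → M) (T S : ℕ) :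
    ∑ t ∈ Finset.Icc 1 T, ∑ s ∈ Finset.Icc 1 S, f t s
      = ∑ i ∈ Finset.range T ×ˢ Finset.range S, f (i.1 + 1) (i.2 + 1) := by
  rw [Finset.sum_product, sum_Icc_one_eq_sum_range]
  simp_rw [sum_Icc_one_eq_sum_range]

lemma sum_Icc_one_const (T S : ℕ) (c : ℝ) :
    ∑ _t ∈ Finset.Icc 1 T, ∑ _s ∈ Finset.Icc 1 S, c = T * S * c := by
  simp [mul_assoc]

/-! ### Uniform strong law -/

section UniformLaw

variable {Ω : Type*} [MeasurableSpace Ω] (P : Measure Ω)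

/-- The centred sum `∑ (|ε + d| - |ε| - E(|ε + d| - |ε|))` over `1 ≤ t ≤ T`, `1 ≤ s ≤ S`, where
`d` is the difference of the signals of `θ₀` and `θ`. -/
noncomputable def deviation (ε : ℕ → ℕ → Ω → ℝ) {p : ℕ} (θ₀ : Param p) (T S : ℕ) (θ : Param p)
    (ω : Ω) : ℝ :=
  ∑ t ∈ Finset.Icc 1 T, ∑ s ∈ Finset.Icc 1 S,
    (|ε t s ω + (signal θ₀ t s - signal θ t s)| - |ε t s ω|
      - meanGain P (ε 1 1) (signal θ₀ t s - signal θ t s))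

variable {P} [IsProbabilityMeasure P] {ε : ℕ → ℕ → Ω → ℝ} {p : ℕ} {θ₀ : Param p}

lemma abs_deviation_sub_le (hε : Measurable (ε 1 1)) {R r : ℝ} (hr : 0 ≤ r) (hR : 0 ≤ R)
    {θ θ' : Param p} (hθ' : InBox R θ') (h : ∀ k, CoordClose r (θ k) (θ' k)) (T S : ℕ) (ω : Ω) :
    |deviation P ε θ₀ T S θ ω - deviation P ε θ₀ T S θ' ω|
      ≤ T * S * (2 * (p * (2 * (1 + R) * r * (T + S)))) := by
  unfold deviation
  rw [← sum_Icc_one_const, ← Finset.sum_sub_distrib]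
  refine (Finset.abs_sum_le_sum_abs _ _).trans (Finset.sum_le_sum fun t ht => ?_)
  rw [← Finset.sum_sub_distrib]
  refine (Finset.abs_sum_le_sum_abs _ _).trans (Finset.sum_le_sum fun s hs => ?_)
  have hsig := abs_signal_sub_le hr hR hθ'.abs_fst_le hθ'.abs_snd_le h ht hs
  set d := signal θ₀ t s - signal θ t s with hd
  set d' := signal θ₀ t s - signal θ' t s with hd'
  have hdd : |d - d'| = |signal θ t s - signal θ' t s| := by
    rw [hd, hd', abs_sub_comm]
    congr 1
    ring
  have h1 := abs_meanGain_sub_le (P := P) hε d d'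
  have h2 : |(|ε t s ω + d| - |ε t s ω + d'|)| ≤ |d - d'| := by
    simpa using abs_abs_sub_abs_le_abs_sub (ε t s ω + d) (ε t s ω + d')
  have e : |ε t s ω + d| - |ε t s ω| - meanGain P (ε 1 1) d
      - (|ε t s ω + d'| - |ε t s ω| - meanGain P (ε 1 1) d')
      = (|ε t s ω + d| - |ε t s ω + d'|)
        - (meanGain P (ε 1 1) d - meanGain P (ε 1 1) d') := by ring
  rw [e]
  have h3 := abs_sub (|ε t s ω + d| - |ε t s ω + d'|)
    (meanGain P (ε 1 1) d - meanGain P (ε 1 1) d')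
  rw [hdd] at h1 h2
  linarith

/-- Both signals are at most `2pR` in absolute value, so the shifts are at most `4pR`; the added `1`
keeps the Hoeffding range positive when `p` or `R` is `0`. -/
lemma measureReal_deviation_ge_le (hmeas : ∀ t s, 1 ≤ t → 1 ≤ s → Measurable (ε t s))
    (hind : iIndepFun (fun i : ℕ × ℕ => ε (i.1 + 1) (i.2 + 1)) P)
    (hlaw : ∀ t s, 1 ≤ t → 1 ≤ s → P.map (ε t s) = P.map (ε 1 1)) {R : ℝ} (hR : 0 ≤ R)
    (hθ₀ : InBox R θ₀) {θ : Param p} (hθ : InBox R θ) (T S : ℕ) {η : ℝ} (hη : 0 ≤ η) :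
    P.real {ω | η * (T * S) ≤ |deviation P ε θ₀ T S θ ω|}
      ≤ 2 * Real.exp (-(η ^ 2 / (2 * (p * (4 * R) + 1) ^ 2)) * (T * S)) := by
  have hd : ∀ i : ℕ × ℕ, |signal θ₀ (i.1 + 1) (i.2 + 1) - signal θ (i.1 + 1) (i.2 + 1)|
      ≤ p * (4 * R) + 1 := fun i => by
    have h1 := abs_signal_le hθ₀.abs_fst_le hθ₀.abs_snd_le (i.1 + 1) (i.2 + 1)
    have h2 := abs_signal_le hθ.abs_fst_le hθ.abs_snd_le (i.1 + 1) (i.2 + 1)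
    have h3 := abs_sub (signal θ₀ (i.1 + 1) (i.2 + 1)) (signal θ (i.1 + 1) (i.2 + 1))
    linarith
  have h := measureReal_sum_gain_ge_le
    (fun i : ℕ × ℕ => hmeas (i.1 + 1) (i.2 + 1) (Nat.succ_pos _) (Nat.succ_pos _)) hind
    (by positivity) hd (Finset.range T ×ˢ Finset.range S) hη
  rw [Finset.card_product, Finset.card_range, Finset.card_range, Nat.cast_mul] at h
  convert h using 7 with ω
  unfold deviation
  rw [sum_Icc_one_Icc_one]
  refine Finset.sum_congr rfl fun i _ => ?_
  rw [meanGain_congr_law (hmeas 1 1 le_rfl le_rfl)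
    (hmeas (i.1 + 1) (i.2 + 1) (Nat.succ_pos _) (Nat.succ_pos _))
    (hlaw (i.1 + 1) (i.2 + 1) (Nat.succ_pos _) (Nat.succ_pos _)).symm]

/-- Uniform strong law: almost surely, for all but finitely many `(T, S)`, the average deviation is
small uniformly over a box of parameters. -/
theorem ae_finite_deviation_gt (hmeas : ∀ t s, 1 ≤ t → 1 ≤ s → Measurable (ε t s))
    (hind : iIndepFun (fun i : ℕ × ℕ => ε (i.1 + 1) (i.2 + 1)) P)
    (hlaw : ∀ t s, 1 ≤ t → 1 ≤ s → P.map (ε t s) = P.map (ε 1 1)) (R : ℕ)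
    (hθ₀ : InBox R θ₀) {η : ℝ} (hη : 0 < η) :
    ∀ᵐ ω ∂P, {n : ℕ × ℕ | ∃ θ : Param p, InBox R θ ∧
      η * ((n.1 + 1 : ℕ) * (n.2 + 1 : ℕ)) < |deviation P ε θ₀ (n.1 + 1) (n.2 + 1) θ ω|}.Finite := by
  -- With mesh `1 / (L (T + S))`, passing to the nearest grid point changes the average deviation by
  -- at most `4p(1 + R)/L`, which is below `η / 2`.
  obtain ⟨L, hL⟩ := exists_nat_gt (8 * p * (1 + R) / η)
  have hL0 : (0 : ℝ) < L := lt_of_le_of_lt (by positivity) hL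
  have hLpos : 0 < L := by exact_mod_cast hL0
  rw [div_lt_iff₀ hη] at hL
  set N : ℕ × ℕ → ℕ := fun n => L * ((n.1 + 1) + (n.2 + 1)) with hN
  have hNpos : ∀ n, 0 < N n := fun n => Nat.mul_pos hLpos (by omega)
  set c : ℝ := (η / 2) ^ 2 / (2 * (p * (4 * R) + 1) ^ 2) with hc
  have hc0 : 0 < c := by positivity
  set bad : ℕ × ℕ → Set Ω := fun n => ⋃ m : GridLabel p (2 * R * N n + 1),
    {ω | η / 2 * ((n.1 + 1 : ℕ) * (n.2 + 1 : ℕ))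
      ≤ |deviation P ε θ₀ (n.1 + 1) (n.2 + 1) (gridParam R (N n) m) ω|} with hbad
  have hprob : ∀ n, P.real (bad n) ≤ 2 * ((2 * R * L * ((n.1 + 1 : ℕ) + (n.2 + 1 : ℕ)) + 1)
      ^ (4 * p) * Real.exp (-c * ((n.1 + 1 : ℕ) * (n.2 + 1 : ℕ)))) := by
    intro n
    refine (measureReal_iUnion_fintype_le _).trans ?_
    refine (Finset.sum_le_sum fun m _ => measureReal_deviation_ge_le hmeas hind hlaw
      (Nat.cast_nonneg R) hθ₀ (inBox_gridParam R (N n) m) (n.1 + 1) (n.2 + 1)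
      (by positivity : 0 ≤ η / 2)).trans ?_
    rw [Finset.sum_const, Finset.card_univ, card_gridLabel, nsmul_eq_mul, hN]
    push_cast
    refine le_of_eq ?_
    rw [hc]
    ring
  have hsum : ∑' n, P (bad n) ≠ ⊤ := by
    have hs := (summable_pow_mul_exp (2 * R * L) (4 * p) hc0).mul_left 2
    have hle : ∀ n, P (bad n) ≤ ENNReal.ofReal (2 * ((2 * R * L * ((n.1 + 1 : ℕ) + (n.2 + 1 : ℕ))
        + 1) ^ (4 * p) * Real.exp (-c * ((n.1 + 1 : ℕ) * (n.2 + 1 : ℕ))))) := fun n => by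
      rw [← ofReal_measureReal]
      exact ENNReal.ofReal_le_ofReal (hprob n)
    exact ne_top_of_le_ne_top hs.tsum_ofReal_ne_top (ENNReal.tsum_le_tsum hle)
  -- Borel–Cantelli. A deviation above `η` anywhere in the box forces one of at least `η / 2` at a
  -- grid point.
  filter_upwards [ae_finite_setOfPred_mem hsum] with ω hω
  refine hω.subset fun n ⟨θ, hθ, hlt⟩ => ?_
  obtain ⟨m, hm⟩ := exists_gridParam R (hNpos n) hθ
  refine Set.mem_iUnion.2 ⟨m, ?_⟩
  have hdev := abs_deviation_sub_le (P := P) (θ₀ := θ₀) (hmeas 1 1 le_rfl le_rfl)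
    (by positivity : (0 : ℝ) ≤ 1 / N n) (Nat.cast_nonneg R) (inBox_gridParam R (N n) m) hm
    (n.1 + 1) (n.2 + 1) ω
  set T : ℝ := ((n.1 + 1 : ℕ) : ℝ) with hT
  set S : ℝ := ((n.2 + 1 : ℕ) : ℝ) with hS
  have hTpos : 0 < T := by rw [hT]; positivity
  have hSpos : 0 < S := by rw [hS]; positivity
  have hNR : (N n : ℝ) = L * (T + S) := by rw [hN, hT, hS]; push_cast; ring
  have hsmall : 2 * (p * (2 * (1 + R) * (1 / (N n : ℝ)) * (T + S))) ≤ η / 2 := by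
    have e : 2 * (p * (2 * (1 + R) * (1 / (N n : ℝ)) * (T + S)))
        = 4 * p * (1 + R) / L := by
      rw [hNR]
      field_simp
      ring
    rw [e, div_le_iff₀ hL0]
    linarith
  have hTS : 0 < T * S := mul_pos hTpos hSpos
  have h1 := mul_le_mul_of_nonneg_left hsmall hTS.le
  have h2 := abs_sub_abs_le_abs_sub (deviation P ε θ₀ (n.1 + 1) (n.2 + 1) θ ω)
    (deviation P ε θ₀ (n.1 + 1) (n.2 + 1) (gridParam R (N n) m) ω)
  change η / 2 * (T * S) ≤ _
  linarith

end UniformLaw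

/-! ### Consistency -/

lemma isCompact_paramSpace (p : ℕ) {K : Set ℝ} (hK : IsCompact K) : IsCompact (paramSpace p K) :=
  isCompact_univ_pi fun _ => hK.prod (hK.prod (isCompact_Icc.prod isCompact_Icc))

lemma exists_inBox_of_mem_paramSpace (p : ℕ) {K : Set ℝ} (hK : IsCompact K) :
    ∃ R : ℕ, ∀ θ ∈ paramSpace p K, InBox R θ := by
  obtain ⟨r, hr⟩ := hK.isBounded.exists_norm_le
  obtain ⟨R, hR⟩ := exists_nat_ge (max r Real.pi)
  have hfreq : ∀ x ∈ Set.Icc 0 Real.pi, |x| ≤ R := fun x hx => by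
    rw [abs_of_nonneg hx.1]
    exact hx.2.trans ((le_max_right _ _).trans hR)
  have hamp : ∀ x ∈ K, |x| ≤ R := fun x hx => (hr x hx).trans ((le_max_left _ _).trans hR)
  refine ⟨R, fun θ hθ k => ?_⟩
  obtain ⟨h1, h2, h3, h4⟩ := hθ k (Set.mem_univ k)
  simpa [CoordClose] using ⟨hamp _ h1, hamp _ h2, hfreq _ h3, hfreq _ h4⟩

lemma freq_mem_Ioo_of_mem_interior {p : ℕ} {K : Set ℝ} {θ : Param p}
    (hθ : θ ∈ interior (paramSpace p K)) (k : Fin p) :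
    θ.freq₁ k ∈ Set.Ioo 0 Real.pi ∧ θ.freq₂ k ∈ Set.Ioo 0 Real.pi := by
  unfold paramSpace at hθ
  rw [interior_pi_set Set.finite_univ] at hθ
  have h := hθ k (Set.mem_univ k)
  simp only [interior_prod_eq, interior_Icc] at h
  exact ⟨h.2.2.1, h.2.2.2⟩

lemma tendsto_fst_min_atTop :
    Tendsto (fun n : ℕ × ℕ => n.1) (comap (fun n : ℕ × ℕ => min n.1 n.2) atTop) atTop :=
  tendsto_atTop_mono (fun _ => min_le_left _ _) tendsto_comap

lemma tendsto_snd_min_atTop :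
    Tendsto (fun n : ℕ × ℕ => n.2) (comap (fun n : ℕ × ℕ => min n.1 n.2) atTop) atTop :=
  tendsto_atTop_mono (fun _ => min_le_right _ _) tendsto_comap

lemma eventually_min_notMem_of_finite {B : Set (ℕ × ℕ)} (hB : B.Finite) :
    ∀ᶠ n : ℕ × ℕ in comap (fun n : ℕ × ℕ => min n.1 n.2) atTop,
      ∃ m : ℕ × ℕ, n = (m.1 + 1, m.2 + 1) ∧ m ∉ B := by
  obtain ⟨N, hN⟩ := (hB.image Prod.fst).bddAbove
  -- `N` bounds the first coordinates in `B`, which are shifted down by one; hence `N + 2`.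
  filter_upwards [tendsto_fst_min_atTop.eventually_ge_atTop (N + 2),
    tendsto_snd_min_atTop.eventually_ge_atTop 1] with n h1 h2
  refine ⟨(n.1 - 1, n.2 - 1), Prod.ext (by simp; omega) (by simp; omega), fun h => ?_⟩
  have : n.1 - 1 ≤ N := hN (Set.mem_image_of_mem Prod.fst h)
  omega

/-- A lower bound for the expected gain turns a bound on the deviation into a bound on the mean
absolute difference of the signals. -/
lemma objective_signal_le {Ω : Type*} [MeasurableSpace Ω] {P : Measure Ω} {ε : ℕ → ℕ → Ω → ℝ}
    {p : ℕ} {θ₀ θ : Param p} {ω : Ω} {y : ℕ → ℕ → ℝ}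
    (hy : ∀ t s, 1 ≤ t → 1 ≤ s → y t s = signal θ₀ t s + ε t s ω) {T S : ℕ} (hT : 1 ≤ T)
    (hS : 1 ≤ S) (hmin : objective y T S θ ≤ objective y T S θ₀) {κ τ η : ℝ} (hκ : 0 < κ)
    (hgain : ∀ x, κ * (|x| - τ) ≤ meanGain P (ε 1 1) x)
    (hdev : |deviation P ε θ₀ T S θ ω| ≤ η * (T * S)) :
    objective (signal θ₀) T S θ ≤ τ + η / κ := by
  have hTS : (0 : ℝ) < T * S := by
    have h1 : (0 : ℝ) < T := by exact_mod_cast hT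
    have h2 : (0 : ℝ) < S := by exact_mod_cast hS
    positivity
  unfold objective at hmin ⊢
  have hle := le_of_mul_le_mul_left hmin (one_div_pos.2 hTS)
  have e1 : ∑ t ∈ Finset.Icc 1 T, ∑ s ∈ Finset.Icc 1 S, |y t s - signal θ t s|
      = ∑ t ∈ Finset.Icc 1 T, ∑ s ∈ Finset.Icc 1 S,
        |ε t s ω + (signal θ₀ t s - signal θ t s)| := by
    refine Finset.sum_congr rfl fun t ht => Finset.sum_congr rfl fun s hs => ?_
    rw [hy t s (Finset.mem_Icc.1 ht).1 (Finset.mem_Icc.1 hs).1]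
    congr 1
    ring
  have e2 : ∑ t ∈ Finset.Icc 1 T, ∑ s ∈ Finset.Icc 1 S, |y t s - signal θ₀ t s|
      = ∑ t ∈ Finset.Icc 1 T, ∑ s ∈ Finset.Icc 1 S, |ε t s ω| := by
    refine Finset.sum_congr rfl fun t ht => Finset.sum_congr rfl fun s hs => ?_
    rw [hy t s (Finset.mem_Icc.1 ht).1 (Finset.mem_Icc.1 hs).1]
    congr 1
    ring
  rw [e1, e2] at hle
  have hmean : ∑ t ∈ Finset.Icc 1 T, ∑ s ∈ Finset.Icc 1 S,
      κ * (|signal θ₀ t s - signal θ t s| - τ)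
      ≤ ∑ t ∈ Finset.Icc 1 T, ∑ s ∈ Finset.Icc 1 S,
        meanGain P (ε 1 1) (signal θ₀ t s - signal θ t s) :=
    Finset.sum_le_sum fun t _ => Finset.sum_le_sum fun s _ => hgain _
  have hlow := (abs_le.1 hdev).1
  unfold deviation at hlow
  simp only [Finset.sum_sub_distrib] at hlow
  simp only [← Finset.mul_sum, Finset.sum_sub_distrib] at hmean
  rw [sum_Icc_one_const] at hmean
  have hfin : κ * (∑ t ∈ Finset.Icc 1 T, ∑ s ∈ Finset.Icc 1 S, |signal θ₀ t s - signal θ t s|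
      - T * S * τ) ≤ η * (T * S) := by linarith
  rw [one_div, inv_mul_le_iff₀ hTS]
  have h3 := (le_div_iff₀' hκ).2 hfin
  have e3 : (T : ℝ) * S * (τ + η / κ) = T * S * τ + η * (T * S) / κ := by ring
  rw [e3]
  linarith

lemma tendsto_objective_signal {Ω : Type*} [MeasurableSpace Ω] {P : Measure Ω} {p : ℕ}
    {K : Set ℝ} {θ₀ : Param p} (hθ₀ : θ₀ ∈ paramSpace p K) {ε : ℕ → ℕ → Ω → ℝ}
    {y : ℕ → ℕ → Ω → ℝ}
    (hy : ∀ t s, 1 ≤ t → 1 ≤ s → ∀ ω, y t s ω = signal θ₀ t s + ε t s ω)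
    {θhat : ℕ → ℕ → Ω → Param p} (hθhat : IsLADEstimator (paramSpace p K) y θhat)
    {R : ℕ} (hR : ∀ θ ∈ paramSpace p K, InBox R θ)
    (hgain : ∀ τ > 0, ∃ κ > 0, ∀ x, κ * (|x| - τ) ≤ meanGain P (ε 1 1) x) {ω : Ω}
    (hω : ∀ j : ℕ, {n : ℕ × ℕ | ∃ θ : Param p, InBox R θ ∧
      1 / ((j : ℝ) + 1) * ((n.1 + 1 : ℕ) * (n.2 + 1 : ℕ))
        < |deviation P ε θ₀ (n.1 + 1) (n.2 + 1) θ ω|}.Finite) :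
    Tendsto (fun n : ℕ × ℕ => objective (signal θ₀) n.1 n.2 (θhat n.1 n.2 ω))
      (comap (fun n : ℕ × ℕ => min n.1 n.2) atTop) (𝓝 0) := by
  rw [Metric.tendsto_nhds]
  intro δ hδ
  obtain ⟨κ, hκ, hκgain⟩ := hgain (δ / 2) (by positivity)
  -- With `η = 1 / (j + 1) < κ δ / 2`, the bound `τ + η / κ` at `τ = δ / 2` is less than `δ`.
  obtain ⟨j, hj⟩ := exists_nat_one_div_lt (by positivity : 0 < κ * (δ / 2))
  filter_upwards [eventually_min_notMem_of_finite (hω j)] with n ⟨m, hnm, hm⟩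
  rw [hnm]
  have hest := hθhat (m.1 + 1) (m.2 + 1) (Nat.succ_pos _) (Nat.succ_pos _) ω
  have hdev : |deviation P ε θ₀ (m.1 + 1) (m.2 + 1) (θhat (m.1 + 1) (m.2 + 1) ω) ω|
      ≤ 1 / ((j : ℝ) + 1) * ((m.1 + 1 : ℕ) * (m.2 + 1 : ℕ)) := by
    by_contra! hc
    exact hm ⟨_, hR _ hest.1, hc⟩
  have hle := objective_signal_le (y := fun t s => y t s ω) (fun t s ht hs => hy t s ht hs ω)
    (Nat.succ_pos _) (Nat.succ_pos _) (hest.2 θ₀ hθ₀) hκ hκgain hdev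
  have hnn : 0 ≤ objective (signal θ₀) (m.1 + 1) (m.2 + 1) (θhat (m.1 + 1) (m.2 + 1) ω) := by
    unfold objective
    positivity
  rw [Real.dist_eq, sub_zero, abs_of_nonneg hnn]
  have h2 : 1 / ((j : ℝ) + 1) / κ < δ / 2 := by
    rw [div_lt_iff₀ hκ]
    linarith
  linarith

/-- Convergence up to relabelling, from convergence of the mean absolute difference of the
signals. -/
lemma exists_perm_tendsto {p : ℕ} {K : Set ℝ} (hK : IsCompact K) {θ₀ : Param p}
    (hθ₀ : θ₀ ∈ interior (paramSpace p K)) (hcomp : HasGenuineComponents θ₀)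
    {θ : ℕ × ℕ → Param p} (hθ : ∀ n, 1 ≤ n.1 → 1 ≤ n.2 → θ n ∈ paramSpace p K)
    (hobj : Tendsto (fun n : ℕ × ℕ => objective (signal θ₀) n.1 n.2 (θ n))
      (comap (fun n : ℕ × ℕ => min n.1 n.2) atTop) (𝓝 0)) :
    ∃ σ : ℕ × ℕ → Equiv.Perm (Fin p), Tendsto (fun n k => θ n (σ n k))
      (comap (fun n : ℕ × ℕ => min n.1 n.2) atTop) (𝓝 θ₀) := by
  -- Choosing the closest relabelling makes `σ` independent of the ultrafilter; along each one it
  -- does at least as well as the fixed permutation given by identifiability.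
  have hmin : ∀ n, ∃ σ : Equiv.Perm (Fin p), ∀ σ' : Equiv.Perm (Fin p),
      dist (fun k => θ n (σ k)) θ₀ ≤ dist (fun k => θ n (σ' k)) θ₀ := fun n =>
    Finite.exists_min fun σ : Equiv.Perm (Fin p) => dist (fun k => θ n (σ k)) θ₀
  choose σ hσ using hmin
  refine ⟨σ, ?_⟩
  rw [tendsto_iff_dist_tendsto_zero, tendsto_iff_ultrafilter]
  intro U hU
  have hT := tendsto_fst_min_atTop.mono_left hU
  have hS := tendsto_snd_min_atTop.mono_left hU
  obtain ⟨τ, hτ, hlim⟩ := (isCompact_paramSpace p hK).ultrafilter_le_nhds (U.map θ) (by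
    rw [le_principal_iff]
    refine Filter.mem_map.2 ?_
    filter_upwards [hT.eventually_ge_atTop 1, hS.eventually_ge_atTop 1] with n h1 h2
    exact hθ n h1 h2)
  have hlim' : Tendsto θ U (𝓝 τ) := hlim
  obtain ⟨ρ, hρ⟩ := exists_perm_of_tendsto_objective U hT hS hcomp
    (fun k => (freq_mem_Ioo_of_mem_interior hθ₀ k).1)
    (fun k => (freq_mem_Ioo_of_mem_interior hθ₀ k).2) hlim'
    (fun k => (hτ k (Set.mem_univ k)).2.2.1) (fun k => (hτ k (Set.mem_univ k)).2.2.2)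
    (hobj.mono_left hU)
  have hconv : Tendsto (fun n k => θ n (ρ k)) U (𝓝 θ₀) := by
    rw [tendsto_pi_nhds]
    intro k
    rw [← hρ k]
    exact tendsto_pi_nhds.1 hlim' (ρ k)
  exact squeeze_zero (fun _ => dist_nonneg) (fun n => hσ n ρ)
    (tendsto_iff_dist_tendsto_zero.1 hconv)

end LAD2D

theorem theorem3 {Ω : Type*} [MeasurableSpace Ω] (P : Measure Ω) [IsProbabilityMeasure P]
    (p : ℕ) (K : Set ℝ) (hK : IsCompact K)
    (θ₀ : LAD2D.Param p) (hθ₀ : θ₀ ∈ interior (LAD2D.paramSpace p K))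
    (hcomp : LAD2D.HasGenuineComponents θ₀)
    (ε : ℕ → ℕ → Ω → ℝ) (G g : ℝ → ℝ) (hε : LAD2D.NoiseAssumption P ε G g)
    (y : ℕ → ℕ → Ω → ℝ)
    (hy : ∀ t s, 1 ≤ t → 1 ≤ s → ∀ ω, y t s ω = LAD2D.signal θ₀ t s + ε t s ω)
    (θhat : ℕ → ℕ → Ω → LAD2D.Param p)
    (hθhat : LAD2D.IsLADEstimator (LAD2D.paramSpace p K) y θhat) :
    ∀ᵐ ω ∂P, ∃ σ : ℕ → ℕ → Equiv.Perm (Fin p),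
      Tendsto (fun n : ℕ × ℕ => fun k : Fin p => θhat n.1 n.2 ω (σ n.1 n.2 k))
        (comap (fun n : ℕ × ℕ => min n.1 n.2) atTop) (𝓝 θ₀) := by
  obtain ⟨R, hR⟩ := LAD2D.exists_inBox_of_mem_paramSpace p hK
  have hθ₀' : θ₀ ∈ LAD2D.paramSpace p K := interior_subset hθ₀
  have hlaw : ∀ t s, 1 ≤ t → 1 ≤ s → P.map (ε t s) = P.map (ε 1 1) := fun t s ht hs => by
    rw [hε.density t s ht hs, hε.density 1 1 le_rfl le_rfl]
  have hgain : ∀ τ > 0, ∃ κ > 0, ∀ x, κ * (|x| - τ) ≤ LAD2D.meanGain P (ε 1 1) x := fun τ hτ =>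
    LAD2D.exists_le_meanGain (hε.measurable 1 1 le_rfl le_rfl)
      (hε.distribution 1 1 le_rfl le_rfl) hε.median hτ
  -- Countably many thresholds `1 / (j + 1)` suffice, so a single null set is discarded.
  filter_upwards [ae_all_iff.2 fun j : ℕ => LAD2D.ae_finite_deviation_gt hε.measurable hε.indep
    hlaw R (hR θ₀ hθ₀') (Nat.one_div_pos_of_nat (n := j))] with ω hω
  obtain ⟨σ, hσ⟩ := LAD2D.exists_perm_tendsto hK hθ₀ hcomp
    (θ := fun n => θhat n.1 n.2 ω) (fun n h1 h2 => (hθhat n.1 n.2 h1 h2 ω).1)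
    (LAD2D.tendsto_objective_signal hθ₀' hy hθhat hR hgain hω)
  exact ⟨fun T S => σ (T, S), hσ⟩
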